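/- Let $G$ be a connected reductive complex linear algebraic group with Lie algebra $\mathcal G$, let $\rho: G\to GL(V)$ be a rational representation on a finite-dimensional complex vector space $V$, and write $g\cdot v=\rho(g)v$ for $g\in G$ and $\mathfrak g\cdot v=d\rho(\mathfrak g)v$ for $\mathfrak g\in\mathcal G$. Let $x\in V$ have stabilizer $H\subseteq G$, and let $H=RQ$ be a Levi decomposition ($Q$ the unipotent radical of $H$, $R$ a reductive complement), with Lie algebras $\mathcal H,\mathcal R,\mathcal Q$. Let $\mathcal S\subseteq\mathcal G$ be an $R$-invariant (under $\mathrm{Ad}$) complement to $\mathcal H$ in $\mathcal G$, and let $N\subseteq V$ be an $R$-invariant complement to the tangent space $T_xO_x=\mathcal G\cdot x$ of the orbit of $x$. Then $(\mathfrak s,n)\mapsto \mathfrak s\cdot x+n$ is a linear isomorphism $\mathcal S\times N\to V$, and $\mathcal G=\mathcal S\oplus\mathcal R\oplus\mathcal Q$. Let $\lambda_{\mathcal S}:V\to\mathcal S$ and $\lambda_N:V\to N$ be the linear maps with $v=\lambda_{\mathcal S}(v)\cdot x+\lambda_N(v)$, and for $n\in N$ let $\theta(n):V\to V$ be $\theta(n)(v)=\lambda_{\mathcal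 S}(v)\cdot n$. There exist complex submanifolds $M$ of $G$ with $e\in M$ and $T_eM=\mathcal S$. For every such $M$ there are open neighbourhoods $M'$ of $e$ in $M$ and $N'$ of $0$ in $N$ such that the following hold. (a) The map $(g,n)\mapsto[g,n]$ embeds $M'\times N'$ as a submanifold of $G\times_H V=(G\times V)/H$, where $h\cdot(g,v)=(gh^{-1},h\cdot v)$: it is a homeomorphism onto its image, and the tangent spaces of $M'\times N'$ meet those of the $H$-orbits in $G\times V$ only in $0$. (b) The map $\mu(g,n)=g\cdot(x+n)$ is a biholomorphic map from $M'\times N'$ onto an open neighbourhood of $x$ in $V$. There is an action $\gamma'$ of $\mathcal G$ on $M'\times N'$, i.e. a Lie algebra homomorphism from $\mathcal G$ to the holomorphic vector fields on $M'\times N'$ (with the sign of the bracket of vector fields for which $A\mapsto(v\mapsto Av)$ is a homomorphism on linear vector fields), for which $\mu$ is $\mathcal G$-equivariant: $d\mu_p(\gamma'(\mathfrak g)(p))=\mathfrak g\cdot\mu(p)$ for all $\mathfrak g\in\mathcal G$ and $p\in M'\times N'$. (c) For all $n\in N'$ the operator $1+\theta(n)$ is invertible, and for $\mathfrak s\in\mathcal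 S$, $\mathfrak r\in\mathcal R$, $\mathfrak q\in\mathcal Q$, $$\gamma'(\mathfrak s+\mathfrak r+\mathfrak q)(e,n)=\bigl(\mathfrak s+\lambda_{\mathcal S}(1+\theta(n))^{-1}(\mathfrak q\cdot n),\ \mathfrak r\cdot n+\lambda_N(1+\theta(n))^{-1}(\mathfrak q\cdot n)\bigr)\in \mathcal S\times N=T_{(e,n)}(M\times N).$$ (d) For all $n\in N'$, let $\mathcal G_n\subseteq\mathcal G$ be the Lie algebra of the stabilizer of $x+n$. There is a subspace $\mathcal H_n\subseteq\mathcal H$ with $\dim\mathcal H_n=\dim\mathcal G_n$ such that, for $\mathfrak r\in\mathcal R$ and $\mathfrak q\in\mathcal Q$, one has $\mathfrak q+\mathfrak r\in\mathcal H_n$ if and only if $$\mathfrak r\cdot n+\lambda_N(1+\theta(n))^{-1}(\mathfrak q\cdot n)=0.\qquad(*)$$ For every $\mathfrak g\in\mathcal G_n$ there is a unique $\mathfrak h=\mathfrak q+\mathfrak r\in\mathcal H_n$ (with $\mathfrak q\in\mathcal Q$, $\mathfrak r\in\mathcal R$ satisfying $(*)$) such that $\mathfrak g=\mathfrak h+\mathfrak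 s$ with $\mathfrak s=-\lambda_{\mathcal S}(1+\theta(n))^{-1}(\mathfrak q\cdot n)$. Conversely, for every $\mathfrak h\in\mathcal H_n$ there is a unique $\mathfrak s\in\mathcal S$ with $\mathfrak h+\mathfrak s\in\mathcal G_n$; the element $\mathfrak h+\mathfrak s$ is the $\mathcal S$-completion of $\mathfrak h$ at $x+n$. -/

import Mathlib

open scoped Manifold ContDiff Topology

/- The commutator bracket on an associative ring. -/
attribute [local instance 100] LieRing.ofAssociativeRing

noncomputable section

namespace LocalModel

/-! ### Linear algebraic groups -/

section Algebraic

variable {m : ℕ}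

/-- The value at the matrix `A` of a polynomial in the `m²` matrix entries. -/
def matEval (A : Matrix (Fin m) (Fin m) ℂ) : MvPolynomial (Fin m × Fin m) ℂ →ₐ[ℂ] ℂ :=
  MvPolynomial.aeval fun ij => A ij.1 ij.2

/-- Zariski closed subsets of `GL m`. -/
def IsZariskiClosed (Z : Set (GL (Fin m) ℂ)) : Prop :=
  ∃ P : Set (MvPolynomial (Fin m × Fin m) ℂ),
    Z = {g : GL (Fin m) ℂ | ∀ f ∈ P, matEval (g : Matrix (Fin m) (Fin m) ℂ) f = 0}

/-- Connectedness in the Zariski topology (for sets that are not empty, such as subgroups). -/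
def IsZariskiConnected (Z : Set (GL (Fin m) ℂ)) : Prop :=
  ∀ A B : Set (GL (Fin m) ℂ), IsZariskiClosed A → IsZariskiClosed B →
    Z ⊆ A ∪ B → Z ∩ (A ∩ B) = ∅ → Z ⊆ A ∨ Z ⊆ B

/-- All elements of the group are unipotent matrices. -/
def IsUnipotentGroup (U : Subgroup (GL (Fin m) ℂ)) : Prop :=
  ∀ u ∈ U, IsNilpotent ((u : Matrix (Fin m) (Fin m) ℂ) - 1)

/-- `U` is a closed connected unipotent normal subgroup of `K`. -/
structure IsConnectedUnipotentNormal (K U : Subgroup (GL (Fin m) ℂ)) : Prop where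
  le : U ≤ K
  closed : IsZariskiClosed (U : Set (GL (Fin m) ℂ))
  connected : IsZariskiConnected (U : Set (GL (Fin m) ℂ))
  unipotent : IsUnipotentGroup U
  normal : ∀ k ∈ K, ∀ u ∈ U, k * u * k⁻¹ ∈ U

/-- `Q` is the unipotent radical of `K`: the largest closed connected unipotent normal subgroup. -/
structure IsUnipotentRadical (K Q : Subgroup (GL (Fin m) ℂ)) : Prop
    extends IsConnectedUnipotentNormal K Q where
  maximal : ∀ U, IsConnectedUnipotentNormal K U → U ≤ Q

/-- `K` is a reductive linear algebraic group: closed, with trivial unipotent radical. -/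
structure IsReductive (K : Subgroup (GL (Fin m) ℂ)) : Prop where
  closed : IsZariskiClosed (K : Set (GL (Fin m) ℂ))
  radical : IsUnipotentRadical K ⊥

/-- A Levi decomposition `H = R Q`: `Q` is the unipotent radical of `H` and `R` is a reductive
complement (so that `H` is the semidirect product of `R` and `Q`). -/
structure IsLeviDecomposition (H R Q : Subgroup (GL (Fin m) ℂ)) : Prop where
  radical : IsUnipotentRadical H Q
  le : R ≤ H
  reductive : IsReductive R
  disjoint : R ⊓ Q = ⊥
  mul_eq : ∀ h ∈ H, ∃ r ∈ R, ∃ q ∈ Q, h = r * q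

/-! ### The Lie algebra -/

/-- The left invariant derivation of the polynomial functions that belongs to the matrix `X`. -/
def leftInv (X : Matrix (Fin m) (Fin m) ℂ) :
    Derivation ℂ (MvPolynomial (Fin m × Fin m) ℂ) (MvPolynomial (Fin m × Fin m) ℂ) :=
  MvPolynomial.mkDerivation ℂ fun ij =>
    ∑ k, MvPolynomial.X (ij.1, k) * MvPolynomial.C (X k ij.2)

/-- The polynomial `A ↦ f (g A)`. -/
def leftMul (g : Matrix (Fin m) (Fin m) ℂ) :
    MvPolynomial (Fin m × Fin m) ℂ →ₐ[ℂ] MvPolynomial (Fin m × Fin m) ℂ :=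
  MvPolynomial.aeval fun ij => ∑ k, MvPolynomial.C (g ij.1 k) * MvPolynomial.X (k, ij.2)

/-- The derivative at the identity of the polynomial function `f` in the direction `X`. -/
def dirDeriv (X : Matrix (Fin m) (Fin m) ℂ) (f : MvPolynomial (Fin m × Fin m) ℂ) : ℂ :=
  ∑ ij : Fin m × Fin m, X ij.1 ij.2 * matEval 1 (MvPolynomial.pderiv ij f)

theorem matEval_leftMul (g A : Matrix (Fin m) (Fin m) ℂ) (f : MvPolynomial (Fin m × Fin m) ℂ) :
    matEval A (leftMul g f) = matEval (g * A) f := by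
  have : (matEval A).comp (leftMul g) = matEval (g * A) := by
    ext ij
    simp [matEval, leftMul, Matrix.mul_apply]
  exact DFunLike.congr_fun this f

theorem matEval_leftInv (A X : Matrix (Fin m) (Fin m) ℂ) (f : MvPolynomial (Fin m × Fin m) ℂ) :
    matEval A (leftInv X f) =
      ∑ ij : Fin m × Fin m, (A * X) ij.1 ij.2 * matEval A (MvPolynomial.pderiv ij f) := by
  classical
  induction f using MvPolynomial.induction_on with
  | C a => simp
  | add p q hp hq => simp [hp, hq, mul_add, Finset.sum_add_distrib]
  | mul_X p ij hp =>
    simp only [Derivation.leibniz, smul_eq_mul, map_add, map_mul, hp, MvPolynomial.pderiv_X,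
      mul_add, Finset.sum_add_distrib]
    congr 1
    · rw [Finset.sum_eq_single ij]
      · simp [leftInv, matEval, Matrix.mul_apply]
        ring
      · intro b _ hb
        simp [hb.symm]
      · simp
    · rw [Finset.mul_sum]
      exact Finset.sum_congr rfl fun _ _ => by ring

theorem dirDeriv_eq (X : Matrix (Fin m) (Fin m) ℂ) (f : MvPolynomial (Fin m × Fin m) ℂ) :
    dirDeriv X f = matEval 1 (leftInv X f) := by
  rw [matEval_leftInv, one_mul, dirDeriv]

theorem leftInv_leftMul (X g : Matrix (Fin m) (Fin m) ℂ)
    (f : MvPolynomial (Fin m × Fin m) ℂ) :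
    leftInv X (leftMul g f) = leftMul g (leftInv X f) := by
  induction f using MvPolynomial.induction_on with
  | C a => simp [leftMul, MvPolynomial.algebraMap_eq]
  | add p q hp hq => simp [hp, hq]
  | mul_X p ij hp =>
    have : leftInv X (leftMul g (MvPolynomial.X ij)) =
        leftMul g (leftInv X (MvPolynomial.X ij)) := by
      simp only [leftInv, leftMul, MvPolynomial.aeval_X, map_sum, Derivation.leibniz,
        MvPolynomial.mkDerivation_X, MvPolynomial.derivation_C, map_mul,
        smul_eq_mul, MvPolynomial.aeval_C, MvPolynomial.algebraMap_eq, Finset.mul_sum,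
        Finset.sum_mul, mul_zero, add_zero]
      rw [Finset.sum_comm]
      simp only [mul_assoc]
    simp only [map_mul, Derivation.leibniz, smul_eq_mul, map_add, hp, this]

theorem leftInv_bracket (X Y : Matrix (Fin m) (Fin m) ℂ) :
    leftInv ⁅X, Y⁆ = ⁅leftInv X, leftInv Y⁆ := by
  refine MvPolynomial.derivation_ext fun ij => ?_
  have h : ∀ A B : Matrix (Fin m) (Fin m) ℂ, leftInv A (leftInv B (MvPolynomial.X ij)) =
      ∑ k, MvPolynomial.X (ij.1, k) * MvPolynomial.C ((A * B) k ij.2) := by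
    intro A B
    simp only [leftInv, MvPolynomial.mkDerivation_X, map_sum, Derivation.leibniz,
      MvPolynomial.derivation_C, smul_eq_mul, mul_zero, zero_add, Matrix.mul_apply, map_mul,
      Finset.mul_sum]
    rw [Finset.sum_comm]
    exact Finset.sum_congr rfl fun _ _ => Finset.sum_congr rfl fun _ _ => by ring
  rw [Derivation.commutator_apply, h, h, ← Finset.sum_sub_distrib]
  simp only [leftInv, MvPolynomial.mkDerivation_X]
  refine Finset.sum_congr rfl fun k _ => ?_
  rw [← mul_sub, ← map_sub]
  rfl

/-- `X` is tangent at the identity to (the Zariski closure of) `K`. -/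
def IsTangentAtOne (K : Subgroup (GL (Fin m) ℂ)) (X : Matrix (Fin m) (Fin m) ℂ) : Prop :=
  ∀ f : MvPolynomial (Fin m × Fin m) ℂ,
    (∀ g ∈ K, matEval (g : Matrix (Fin m) (Fin m) ℂ) f = 0) → dirDeriv X f = 0

theorem IsTangentAtOne.leftInv_vanish {K : Subgroup (GL (Fin m) ℂ)}
    {X : Matrix (Fin m) (Fin m) ℂ} (hX : IsTangentAtOne K X)
    {f : MvPolynomial (Fin m × Fin m) ℂ}
    (hf : ∀ g ∈ K, matEval (g : Matrix (Fin m) (Fin m) ℂ) f = 0) :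
    ∀ g ∈ K, matEval (g : Matrix (Fin m) (Fin m) ℂ) (leftInv X f) = 0 := by
  intro g hg
  have h1 : dirDeriv X (leftMul (g : Matrix (Fin m) (Fin m) ℂ) f) = 0 := by
    refine hX _ fun k hk => ?_
    rw [matEval_leftMul]
    simpa using hf (g * k) (K.mul_mem hg hk)
  rwa [dirDeriv_eq, leftInv_leftMul, matEval_leftMul, mul_one] at h1

/-- The Lie algebra of a linear algebraic group `K`: the tangent space of `K` at the identity, with
the commutator of matrices as its bracket. -/
def lieAlg (K : Subgroup (GL (Fin m) ℂ)) : LieSubalgebra ℂ (Matrix (Fin m) (Fin m) ℂ) where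
  carrier := {X | IsTangentAtOne K X}
  zero_mem' := fun f _ => by simp [dirDeriv]
  add_mem' := fun {X Y} hX hY f hf => by
    have h1 := hX f hf
    have h2 := hY f hf
    simp only [dirDeriv] at h1 h2 ⊢
    simp [add_mul, Finset.sum_add_distrib, h1, h2]
  smul_mem' := fun c X hX f hf => by
    have h1 := hX f hf
    simp only [dirDeriv] at h1 ⊢
    simp [mul_assoc, ← Finset.mul_sum, h1]
  lie_mem' := fun {X Y} hX hY f hf => by
    have h1 := hX _ (hY.leftInv_vanish hf)
    have h2 := hY _ (hX.leftInv_vanish hf)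
    rw [dirDeriv_eq] at h1 h2
    rw [dirDeriv_eq, leftInv_bracket, Derivation.commutator_apply, map_sub, h1, h2, sub_zero]

/-- The Lie algebra of a closed subgroup `K` of `G`, inside the Lie algebra of `G`. -/
def lieIn (G K : Subgroup (GL (Fin m) ℂ)) : Submodule ℂ (lieAlg G) :=
  (lieAlg K).toSubmodule.comap (lieAlg G).toSubmodule.subtype

/-- The exponential of a matrix, as an invertible matrix. -/
def expGL (X : Matrix (Fin m) (Fin m) ℂ) : GL (Fin m) ℂ :=
  (Matrix.isUnit_exp X).unit

@[simp]
theorem coe_expGL (X : Matrix (Fin m) (Fin m) ℂ) :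
    ((expGL X : GL (Fin m) ℂ) : Matrix (Fin m) (Fin m) ℂ) = NormedSpace.exp X := rfl

theorem hasDerivAt_exp_entry (X : Matrix (Fin m) (Fin m) ℂ) (i j : Fin m) (t : ℂ) :
    HasDerivAt (fun s : ℂ => (NormedSpace.exp (s • X)) i j)
      ((NormedSpace.exp (t • X) * X) i j) t := by
  let _ : NormedRing (Matrix (Fin m) (Fin m) ℂ) := Matrix.linftyOpNormedRing
  let _ : NormedAlgebra ℂ (Matrix (Fin m) (Fin m) ℂ) := Matrix.linftyOpNormedAlgebra
  have h := hasDerivAt_exp_smul_const (𝕂 := ℂ) X t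
  exact (LinearMap.toContinuousLinearMap
    (Matrix.entryLinearMap ℂ ℂ i j)).hasFDerivAt.comp_hasDerivAt t h

theorem hasDerivAt_matEval_exp (X : Matrix (Fin m) (Fin m) ℂ)
    (f : MvPolynomial (Fin m × Fin m) ℂ) (t : ℂ) :
    HasDerivAt (fun s : ℂ => matEval (NormedSpace.exp (s • X)) f)
      (matEval (NormedSpace.exp (t • X)) (leftInv X f)) t := by
  induction f using MvPolynomial.induction_on with
  | C a =>
    simp only [matEval, MvPolynomial.aeval_C, MvPolynomial.derivation_C, map_zero]
    exact hasDerivAt_const _ _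
  | add p q hp hq =>
    simp only [map_add]
    exact hp.add hq
  | mul_X p ij hp =>
    have hX : HasDerivAt (fun s : ℂ => matEval (NormedSpace.exp (s • X)) (MvPolynomial.X ij))
        (matEval (NormedSpace.exp (t • X)) (leftInv X (MvPolynomial.X ij))) t := by
      simpa [matEval, leftInv, Matrix.mul_apply] using hasDerivAt_exp_entry X ij.1 ij.2 t
    simp only [map_mul, Derivation.leibniz, smul_eq_mul, map_add]
    refine (hp.mul hX).congr_deriv ?_
    ring

theorem expGL_mem {G : Subgroup (GL (Fin m) ℂ)} (hG : IsZariskiClosed (G : Set (GL (Fin m) ℂ)))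
    {X : Matrix (Fin m) (Fin m) ℂ} (hX : X ∈ lieAlg G) : expGL X ∈ G := by
  have key : ∀ f : MvPolynomial (Fin m × Fin m) ℂ,
      (∀ g ∈ G, matEval (g : Matrix (Fin m) (Fin m) ℂ) f = 0) →
      matEval (NormedSpace.exp X) f = 0 := by
    intro f hf
    have hit : ∀ n : ℕ, iteratedDeriv n (fun s : ℂ => matEval (NormedSpace.exp (s • X)) f) =
        fun s : ℂ => matEval (NormedSpace.exp (s • X)) ((leftInv X)^[n] f) := by
      intro n
      induction n with
      | zero => simp
      | succ n ih =>
        rw [iteratedDeriv_succ, ih]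
        ext s
        rw [(hasDerivAt_matEval_exp X _ s).deriv, Function.iterate_succ_apply']
    have hvan : ∀ n : ℕ, ∀ g ∈ G,
        matEval (g : Matrix (Fin m) (Fin m) ℂ) ((leftInv X)^[n] f) = 0 := by
      intro n
      induction n with
      | zero => simpa using hf
      | succ n ih =>
        intro g hg
        rw [Function.iterate_succ_apply']
        exact IsTangentAtOne.leftInv_vanish hX ih g hg
    have hd : Differentiable ℂ (fun s : ℂ => matEval (NormedSpace.exp (s • X)) f) :=
      fun s => (hasDerivAt_matEval_exp X f s).differentiableAt
    have h := Complex.taylorSeries_eq_of_entire hd 0 1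
    have hz : ∀ n : ℕ, iteratedDeriv n
        (fun s : ℂ => matEval (NormedSpace.exp (s • X)) f) 0 = 0 := by
      intro n
      rw [hit]
      simpa using hvan n 1 G.one_mem
    simpa [hz] using h.symm
  obtain ⟨P, hP⟩ := hG
  have hmem : ∀ g : GL (Fin m) ℂ,
      g ∈ G ↔ ∀ f ∈ P, matEval (g : Matrix (Fin m) (Fin m) ℂ) f = 0 := by
    intro g
    rw [← SetLike.mem_coe, hP]
    rfl
  rw [hmem]
  intro f hf
  exact key f fun g hg => (hmem g).1 hg f hf

/-- The exponential map of a closed subgroup of `GL m`. -/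
def expG {G : Subgroup (GL (Fin m) ℂ)} (hG : IsZariskiClosed (G : Set (GL (Fin m) ℂ)))
    (X : lieAlg G) : G :=
  ⟨expGL (X : Matrix (Fin m) (Fin m) ℂ), expGL_mem hG X.2⟩

end Algebraic

/-! ### Rational representations -/

section Representation

variable {m : ℕ} {G : Subgroup (GL (Fin m) ℂ)}
  {V : Type*} [NormedAddCommGroup V] [NormedSpace ℂ V]

/-- The representation `ρ` of `G` is rational: its matrix coefficients are polynomials in the matrix
entries and the inverse of the determinant. -/
def IsRational (ρ : Representation ℂ G V) : Prop :=
  ∀ (v : V) (φ : Module.Dual ℂ V), ∃ (f : MvPolynomial (Fin m × Fin m) ℂ) (k : ℕ), ∀ g : G,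
    φ (ρ g v) = matEval ((g : GL (Fin m) ℂ) : Matrix (Fin m) (Fin m) ℂ) f *
      (((g : GL (Fin m) ℂ) : Matrix (Fin m) (Fin m) ℂ).det)⁻¹ ^ k

theorem exists_hasDerivAt_coeff (hG : IsZariskiClosed (G : Set (GL (Fin m) ℂ)))
    {ρ : Representation ℂ G V} (hρ : IsRational ρ) (v : V) (φ : Module.Dual ℂ V) :
    ∃ L : lieAlg G →ₗ[ℂ] ℂ, ∀ X : lieAlg G,
      HasDerivAt (fun t : ℂ => φ (ρ (expG hG (t • X)) v)) (L X) 0 := by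
  obtain ⟨f, k, hf⟩ := hρ v φ
  have hdet : ∀ A : Matrix (Fin m) (Fin m) ℂ,
      matEval A (Matrix.det (Matrix.mvPolynomialX (Fin m) (Fin m) ℂ)) = A.det := by
    intro A
    rw [AlgHom.map_det]
    congr 1
    ext i j
    simp [matEval, Matrix.mvPolynomialX]
  have hlin : ∀ p : MvPolynomial (Fin m × Fin m) ℂ,
      ∃ L : lieAlg G →ₗ[ℂ] ℂ, ∀ X : lieAlg G, L X = dirDeriv (X : Matrix (Fin m) (Fin m) ℂ) p := by
    intro p
    refine ⟨{ toFun := fun X => dirDeriv (X : Matrix (Fin m) (Fin m) ℂ) p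
              map_add' := fun X Y => ?_
              map_smul' := fun c X => ?_ }, fun X => rfl⟩
    · simp [dirDeriv, add_mul, Finset.sum_add_distrib]
    · simp [dirDeriv, mul_assoc, Finset.mul_sum]
  obtain ⟨L₁, hL₁⟩ := hlin f
  obtain ⟨L₂, hL₂⟩ := hlin (Matrix.det (Matrix.mvPolynomialX (Fin m) (Fin m) ℂ))
  refine ⟨L₁ - ((k : ℂ) * matEval 1 f) • L₂, fun X => ?_⟩
  have h1 := hasDerivAt_matEval_exp (X : Matrix (Fin m) (Fin m) ℂ) f 0
  have h2 := hasDerivAt_matEval_exp (X : Matrix (Fin m) (Fin m) ℂ)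
    (Matrix.det (Matrix.mvPolynomialX (Fin m) (Fin m) ℂ)) 0
  simp only [hdet, zero_smul, NormedSpace.exp_zero, ← dirDeriv_eq] at h1 h2
  rw [← hL₁] at h1
  rw [← hL₂] at h2
  have h3 := h1.mul ((h2.inv (by simp)).pow k)
  have h4 : (fun t : ℂ => φ (ρ (expG hG (t • X)) v)) =
      (fun t : ℂ => matEval (NormedSpace.exp (t • (X : Matrix (Fin m) (Fin m) ℂ))) f) *
        (fun t : ℂ => (NormedSpace.exp (t • (X : Matrix (Fin m) (Fin m) ℂ))).det)⁻¹ ^ k := by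
    ext t
    simp [hf, expG]
  rw [h4]
  refine h3.congr_deriv ?_
  simp
  ring

/-- The differential of the rational representation `ρ`, as a linear map into the endomorphisms of
`V`; the value at `X` and `v` is the derivative at `t = 0` of `ρ (exp (t X)) v`. -/
def dRep [FiniteDimensional ℂ V] (hG : IsZariskiClosed (G : Set (GL (Fin m) ℂ)))
    {ρ : Representation ℂ G V} (hρ : IsRational ρ) : lieAlg G →ₗ[ℂ] Module.End ℂ V :=
  have hdiff : ∀ (v : V) (X : lieAlg G),
      DifferentiableAt ℂ (fun t : ℂ => ρ (expG hG (t • X)) v) 0 := by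
    intro v X
    let b := Module.finBasis ℂ V
    have hs : (fun t : ℂ => ρ (expG hG (t • X)) v) =
        fun t : ℂ => ∑ i, b.coord i (ρ (expG hG (t • X)) v) • b i := by
      ext t
      exact (b.sum_repr _).symm
    rw [hs]
    refine DifferentiableAt.fun_sum fun i _ => ?_
    obtain ⟨L, hL⟩ := exists_hasDerivAt_coeff hG hρ v (b.coord i)
    exact (hL X).differentiableAt.smul_const _
  have hcoeff : ∀ (v : V) (φ : Module.Dual ℂ V) (c : ℂ)
      (X : lieAlg G), HasDerivAt (fun t : ℂ => φ (ρ (expG hG (t • X)) v)) c 0 →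
      φ (deriv (fun t : ℂ => ρ (expG hG (t • X)) v) 0) = c := by
    intro v φ c X hc
    exact ((LinearMap.toContinuousLinearMap φ).hasFDerivAt.comp_hasDerivAt (0 : ℂ)
      (hdiff v X).hasDerivAt).unique hc
  LinearMap.mk₂ ℂ (fun X v => deriv (fun t : ℂ => ρ (expG hG (t • X)) v) 0)
    (fun X Y v => by
      rw [← sub_eq_zero, ← Module.forall_dual_apply_eq_zero_iff ℂ]
      intro φ
      obtain ⟨L, hL⟩ := exists_hasDerivAt_coeff hG hρ v φ
      rw [map_sub, map_add, hcoeff v φ _ _ (hL _), hcoeff v φ _ _ (hL _), hcoeff v φ _ _ (hL _)]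
      simp)
    (fun c X v => by
      rw [← sub_eq_zero, ← Module.forall_dual_apply_eq_zero_iff ℂ]
      intro φ
      obtain ⟨L, hL⟩ := exists_hasDerivAt_coeff hG hρ v φ
      rw [map_sub, map_smul, hcoeff v φ _ _ (hL _), hcoeff v φ _ _ (hL _)]
      simp)
    (fun X v w => by
      simp only [map_add]
      exact deriv_fun_add (hdiff v X) (hdiff w X))
    (fun c X v => by
      simp only [map_smul]
      exact deriv_fun_const_smul c (hdiff v X))

theorem dRep_apply [FiniteDimensional ℂ V] (hG : IsZariskiClosed (G : Set (GL (Fin m) ℂ)))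
    {ρ : Representation ℂ G V} (hρ : IsRational ρ) (X : lieAlg G) (v : V) :
    dRep hG hρ X v = deriv (fun t : ℂ => ρ (expG hG (t • X)) v) 0 := rfl

/-- The stabilizer of the point `x`, as a subgroup of `GL m` (contained in `G`). -/
def stabilizer (ρ : Representation ℂ G V) (x : V) : Subgroup (GL (Fin m) ℂ) :=
  Subgroup.map G.subtype
    { carrier := {g : G | ρ g x = x}
      one_mem' := by simp
      mul_mem' := fun {a b} (ha : ρ a x = x) (hb : ρ b x = x) => by
        simp [Module.End.mul_apply, ha, hb]
      inv_mem' := fun {a} (ha : ρ a x = x) => by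
        change ρ a⁻¹ x = x
        conv_lhs => rw [← ha]
        rw [← Module.End.mul_apply, ← map_mul]
        simp }

variable [FiniteDimensional ℂ V]

/-- The tangent space at `x` of the orbit of `x`: the image of the differential at the identity of
the orbit map `g ↦ g x`. -/
def orbitTangent (hG : IsZariskiClosed (G : Set (GL (Fin m) ℂ)))
    {ρ : Representation ℂ G V} (hρ : IsRational ρ) (x : V) : Submodule ℂ V :=
  LinearMap.range ((dRep hG hρ).flip x)

/-! ### The maps `λ_S`, `λ_N` and `θ` -/

/-- The linear map `(s, n) ↦ s · x + n` from `S × N` to `V`. -/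
def sliceMap (hG : IsZariskiClosed (G : Set (GL (Fin m) ℂ)))
    {ρ : Representation ℂ G V} (hρ : IsRational ρ) (x : V)
    (S : Submodule ℂ (lieAlg G)) (N : Submodule ℂ V) : (S × N) →ₗ[ℂ] V :=
  LinearMap.coprod (((dRep hG hρ).flip x).comp S.subtype) N.subtype

open Classical in
/-- The inverse of the map `(s, n) ↦ s · x + n` (zero if that map is not bijective). -/
def sliceInv (hG : IsZariskiClosed (G : Set (GL (Fin m) ℂ)))
    {ρ : Representation ℂ G V} (hρ : IsRational ρ) (x : V)
    (S : Submodule ℂ (lieAlg G)) (N : Submodule ℂ V) : V →ₗ[ℂ] (S × N) :=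
  if h : Function.Bijective (sliceMap hG hρ x S N) then
    (LinearEquiv.ofBijective (sliceMap hG hρ x S N) h).symm.toLinearMap
  else 0

/-- The projection `λ_S : V → S`, where `v = λ_S(v) · x + λ_N(v)`. -/
def lamS (hG : IsZariskiClosed (G : Set (GL (Fin m) ℂ)))
    {ρ : Representation ℂ G V} (hρ : IsRational ρ) (x : V)
    (S : Submodule ℂ (lieAlg G)) (N : Submodule ℂ V) : V →ₗ[ℂ] S :=
  (LinearMap.fst ℂ S N).comp (sliceInv hG hρ x S N)

/-- The projection `λ_N : V → N`, where `v = λ_S(v) · x + λ_N(v)`. -/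
def lamN (hG : IsZariskiClosed (G : Set (GL (Fin m) ℂ)))
    {ρ : Representation ℂ G V} (hρ : IsRational ρ) (x : V)
    (S : Submodule ℂ (lieAlg G)) (N : Submodule ℂ V) : V →ₗ[ℂ] N :=
  (LinearMap.snd ℂ S N).comp (sliceInv hG hρ x S N)

/-- The operator `θ(n) : V → V`, `θ(n)(v) = λ_S(v) · n`. -/
def theta (hG : IsZariskiClosed (G : Set (GL (Fin m) ℂ)))
    {ρ : Representation ℂ G V} (hρ : IsRational ρ) (x : V)
    (S : Submodule ℂ (lieAlg G)) (N : Submodule ℂ V) (n : N) : Module.End ℂ V :=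
  (((dRep hG hρ).flip (n : V)).comp S.subtype).comp (lamS hG hρ x S N)

/-- The operator `(1 + θ(n))⁻¹` (zero if `1 + θ(n)` is not invertible). -/
def thetaInv (hG : IsZariskiClosed (G : Set (GL (Fin m) ℂ)))
    {ρ : Representation ℂ G V} (hρ : IsRational ρ) (x : V)
    (S : Submodule ℂ (lieAlg G)) (N : Submodule ℂ V) (n : N) : Module.End ℂ V :=
  Ring.inverse (1 + theta hG hρ x S N n)

/-! ### The associated bundle -/

/-- The equivalence relation on `G × V` given by the action `h · (g, v) = (g h⁻¹, h v)` of the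
stabilizer `H` of `x`. -/
def assocSetoid (ρ : Representation ℂ G V) (x : V) : Setoid (G × V) where
  r a b := ∃ h : G, ρ h x = x ∧ b = (a.1 * h⁻¹, ρ h a.2)
  iseqv :=
    { refl := fun a => ⟨1, by simp, by simp⟩
      symm := by
        rintro a b ⟨h, hx, rfl⟩
        refine ⟨h⁻¹, ?_, ?_⟩
        · conv_lhs => rw [← hx]
          rw [← Module.End.mul_apply, ← map_mul]
          simp
        · ext1
          · simp
          · change a.2 = ρ h⁻¹ (ρ h a.2)
            rw [← Module.End.mul_apply, ← map_mul]
            simp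
      trans := by
        rintro a b c ⟨h, hx, rfl⟩ ⟨k, kx, rfl⟩
        refine ⟨k * h, ?_, ?_⟩
        · simp [Module.End.mul_apply, hx, kx]
        · ext1
          · simp [mul_assoc]
          · simp [Module.End.mul_apply] }

/-- The space `G ×_H V`, with the quotient topology. -/
abbrev AssocBundle (ρ : Representation ℂ G V) (x : V) : Type _ := Quotient (assocSetoid ρ x)

end Representation

/-! ### Submanifolds of `G` and infinitesimal actions -/

section Manifolds

variable {m : ℕ} {G : Subgroup (GL (Fin m) ℂ)}

/-- The inclusion of a subset of `G` into the space of matrices, seen as families of entries. -/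
def toMat (M : Set G) (p : M) : Fin m → Fin m → ℂ :=
  fun i j => (((p : G) : GL (Fin m) ℂ) : Matrix (Fin m) (Fin m) ℂ) i j

/-- The differential at `p` of the inclusion of `M` into the space of matrices. -/
def dToMat (d : ℕ) (M : Set G) [ChartedSpace (EuclideanSpace ℂ (Fin d)) M] (p : M)
    (w : TangentSpace 𝓘(ℂ, EuclideanSpace ℂ (Fin d)) p) : Matrix (Fin m) (Fin m) ℂ :=
  Matrix.of (mfderiv 𝓘(ℂ, EuclideanSpace ℂ (Fin d)) 𝓘(ℂ, Fin m → Fin m → ℂ) (toMat M) p w)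

/-- The subset `M` of `G`, with the subspace topology and the given charts, is a complex submanifold
(its inclusion into the matrices is a holomorphic immersion) through the identity, whose tangent
space at the identity is `S`. -/
structure IsTransversal (d : ℕ) (S : Submodule ℂ (lieAlg G)) (M : Set G)
    [ChartedSpace (EuclideanSpace ℂ (Fin d)) M] : Prop where
  holomorphic : ContMDiff 𝓘(ℂ, EuclideanSpace ℂ (Fin d)) 𝓘(ℂ, Fin m → Fin m → ℂ) ω (toMat M)
  immersion : ∀ p : M, Function.Injective (dToMat d M p)
  one_mem : (1 : G) ∈ M
  tangent : Set.range (dToMat d M ⟨1, one_mem⟩) =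
    {X : Matrix (Fin m) (Fin m) ℂ | ∃ s ∈ S, (s : Matrix (Fin m) (Fin m) ℂ) = X}

/-- An infinitesimal action of the Lie algebra `L` on the open subset `U` of the complex manifold
`X`: a linear map `γ` from `L` to the holomorphic vector fields on `U` that respects brackets. As
usual for left actions, the bracket of vector fields is the one with the sign for which
`A ↦ (v ↦ A v)` is a homomorphism on linear vector fields, i.e. `[ξ, η] = dξ(η) - dη(ξ)` in a chart;
this is `mlieBracket I η ξ`. -/
structure IsInfinitesimalAction {L : Type*} [LieRing L] [LieAlgebra ℂ L]
    {E : Type*} [NormedAddCommGroup E] [NormedSpace ℂ E]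
    {B : Type*} [TopologicalSpace B] (I : ModelWithCorners ℂ E B)
    {X : Type*} [TopologicalSpace X] [ChartedSpace B X] [IsManifold I 1 X]
    (γ : L →ₗ[ℂ] ((p : X) → TangentSpace I p)) (U : Set X) : Prop where
  holomorphic : ∀ a : L,
    ContMDiffOn I I.tangent ω (fun p => (⟨p, γ a p⟩ : TangentBundle I X)) U
  bracket : ∀ a b : L, ∀ p ∈ U, γ ⁅a, b⁆ p = VectorField.mlieBracket I (γ b) (γ a) p

/-- The map `μ : M × N → V`, `μ(g, n) = g · (x + n)`. -/
def mu {V : Type*} [NormedAddCommGroup V] [NormedSpace ℂ V] (ρ : Representation ℂ G V) (x : V)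
    (M : Set G) (N : Submodule ℂ V) (p : M × N) : V :=
  ρ (p.1 : G) (x + (p.2 : V))

end Manifolds

end LocalModel

end

/-! Everything comes from the inverse function theorem applied to `mu` at `(e, 0)`. An element of
the Lie algebra of `G` kills `x` exactly when it lies in the Lie algebra of the stabilizer
(`mem_lieIn_stabilizer`). Hence `S` maps isomorphically onto the tangent space of the orbit, and the
derivative `(s, u) ↦ s · x + u` of `mu` at `(e, 0)` is an isomorphism. So `mu` is biholomorphic on a
box `M' × N'`, and its derivative is invertible at every point of the box.

The embedding in `G ×_H V` follows because `mu` factors through `[g, v] ↦ g · (x + v)`.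
Transversality to the `H`-orbits follows because the derivative of this map kills their tangent
vectors. The infinitesimal action is the pullback under `mu` of the linear vector fields on `V`.
Pullback respects brackets, and `dRep` is a Lie algebra homomorphism (`dRep_lie`).

The explicit formulas are linear algebra. At `(e, n)` the derivative of `mu` is `(s, u) ↦ s · (x +
n) + u`, and precomposing it with the inverse of the slice isomorphism gives `1 + θ(n)`
(`one_add_theta_apply`). Thus the only solution of `s · (x + n) + u = v` is `λ_S (1 + θ(n))⁻¹ v`,
`λ_N (1 + θ(n))⁻¹ v` (`eq_of_add_eq`). This is used with `v = q · n`, after moving `r · n` into `N`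
by the invariance of `N`. The space `H_n` is the projection along `S` to the Lie algebra of `H` of
the stabilizer algebra of `x + n`.

Two inputs are analytic. A rational representation extends holomorphically to a neighbourhood of `G`
in the space of matrices, so it can be differentiated there. The Lie algebra of `H = R Q` is the sum
of those of `R` and `Q` (`exists_add_of_semidirect`), by an open mapping argument for topological
groups. -/

namespace LocalModel

/-! ### Calculus on the space of matrices and tangent vectors of matrix groups. -/

section MatrixAnalysis

attribute [local instance] Matrix.normedAddCommGroup Matrix.normedSpace

section MatrixFunctions

variable {m : ℕ}

theorem hasDerivAt_matrix {𝕜 : Type*} [NontriviallyNormedField 𝕜] [NormedAlgebra 𝕜 ℂ]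
    {c : 𝕜 → Matrix (Fin m) (Fin m) ℂ} {C : Matrix (Fin m) (Fin m) ℂ} {t : 𝕜} :
    HasDerivAt c C t ↔ ∀ i j, HasDerivAt (fun s => c s i j) (C i j) t :=
  hasDerivAt_pi.trans (forall_congr' fun _ => hasDerivAt_pi)

theorem contDiff_matEval (f : MvPolynomial (Fin m × Fin m) ℂ) :
    ContDiff ℂ ω (fun A : Matrix (Fin m) (Fin m) ℂ => matEval A f) := by
  induction f using MvPolynomial.induction_on with
  | C a =>
    simp only [matEval, MvPolynomial.aeval_C]
    exact contDiff_const
  | add p q hp hq =>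
    simp only [map_add]
    exact hp.add hq
  | mul_X p ij hp =>
    simp only [map_mul]
    refine hp.mul ?_
    simp only [matEval, MvPolynomial.aeval_X, ]
    fun_prop

theorem differentiable_matEval (f : MvPolynomial (Fin m × Fin m) ℂ) :
    Differentiable ℂ (fun A : Matrix (Fin m) (Fin m) ℂ => matEval A f) :=
  (contDiff_matEval f).differentiable (by simp)

/-- Links the algebraic tangent space to calculus: both sides are the derivative of `f` along `s ↦
exp (s X)` at `0`. -/
theorem fderiv_matEval_one (f : MvPolynomial (Fin m × Fin m) ℂ)
    (X : Matrix (Fin m) (Fin m) ℂ) :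
    fderiv ℂ (fun A : Matrix (Fin m) (Fin m) ℂ => matEval A f)
      (1 : Matrix (Fin m) (Fin m) ℂ) X = dirDeriv X f := by
  have h1 := hasDerivAt_matEval_exp X f 0
  have h2 : HasDerivAt (fun s : ℂ => (NormedSpace.exp (s • X)))
      (X) 0 := by
    refine hasDerivAt_matrix.2 fun i j => ?_
    simpa using hasDerivAt_exp_entry X i j 0
  have h3 : HasFDerivAt (fun A : Matrix (Fin m) (Fin m) ℂ => matEval A f)
      (fderiv ℂ (fun A : Matrix (Fin m) (Fin m) ℂ => matEval A f)
        (1 : Matrix (Fin m) (Fin m) ℂ))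
      (NormedSpace.exp ((0 : ℂ) • X) : Matrix (Fin m) (Fin m) ℂ) := by
    rw [zero_smul, NormedSpace.exp_zero]
    exact (differentiable_matEval f _).hasFDerivAt
  have h4 := h3.comp_hasDerivAt (0 : ℂ) h2
  have h5 := h4.unique h1
  rw [zero_smul, NormedSpace.exp_zero] at h5
  rw [dirDeriv_eq]
  exact h5

theorem matEval_det (A : Matrix (Fin m) (Fin m) ℂ) :
    matEval A (Matrix.det (Matrix.mvPolynomialX (Fin m) (Fin m) ℂ)) = A.det := by
  rw [AlgHom.map_det]
  congr 1
  ext i j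
  simp [matEval, Matrix.mvPolynomialX]

theorem contDiff_det :
    ContDiff ℂ ω (fun A : Matrix (Fin m) (Fin m) ℂ => A.det) := by
  simpa only [matEval_det] using
    contDiff_matEval (Matrix.det (Matrix.mvPolynomialX (Fin m) (Fin m) ℂ))

/-- A matrix is tangent to `K` if it is the derivative of a real curve of elements of `K`. -/
theorem isTangentAtOne_of_hasDerivAt {K : Subgroup (GL (Fin m) ℂ)} {c : ℝ → GL (Fin m) ℂ}
    {X : Matrix (Fin m) (Fin m) ℂ} (hc : ∀ t, c t ∈ K) (h0 : c 0 = 1)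
    (h : HasDerivAt (fun t => ((c t : Matrix (Fin m) (Fin m) ℂ)))
      (X) 0) : IsTangentAtOne K X := by
  intro f hf
  have h3 : HasFDerivAt (fun A : Matrix (Fin m) (Fin m) ℂ => matEval A f)
      (fderiv ℂ (fun A : Matrix (Fin m) (Fin m) ℂ => matEval A f)
        (1 : Matrix (Fin m) (Fin m) ℂ)) ((c 0 : GL (Fin m) ℂ) : Matrix (Fin m) (Fin m) ℂ) := by
    rw [h0]
    exact (differentiable_matEval f _).hasFDerivAt
  have h4 := (h3.restrictScalars ℝ).comp_hasDerivAt (0 : ℝ) h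
  have h5 : (fun A : Matrix (Fin m) (Fin m) ℂ => matEval A f) ∘
      (fun t => ((c t : Matrix (Fin m) (Fin m) ℂ))) = fun _ => 0 := by
    ext t
    exact hf _ (hc t)
  rw [h5] at h4
  have h6 := h4.unique (hasDerivAt_const _ _)
  rw [← fderiv_matEval_one]
  exact h6

theorem lieAlg_mono {K L : Subgroup (GL (Fin m) ℂ)} (h : K ≤ L) : lieAlg K ≤ lieAlg L :=
  fun _ hX f hf => hX f fun g hg => hf g (h hg)

theorem lieIn_mono (G : Subgroup (GL (Fin m) ℂ)) {K L : Subgroup (GL (Fin m) ℂ)} (h : K ≤ L) :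
    lieIn G K ≤ lieIn G L :=
  fun _ hX => lieAlg_mono h hX

theorem mem_lieIn {G K : Subgroup (GL (Fin m) ℂ)} {X : lieAlg G} :
    X ∈ lieIn G K ↔ (X : Matrix (Fin m) (Fin m) ℂ) ∈ lieAlg K := Iff.rfl

theorem hasDerivAt_exp_smul (X : Matrix (Fin m) (Fin m) ℂ) (t : ℂ) :
    HasDerivAt (fun s : ℂ => (NormedSpace.exp (s • X)))
      (NormedSpace.exp (t • X) * X : Matrix (Fin m) (Fin m) ℂ) t :=
  hasDerivAt_matrix.2 fun i j => hasDerivAt_exp_entry X i j t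

theorem hasDerivAt_real_exp_smul (X : Matrix (Fin m) (Fin m) ℂ) (t : ℝ) :
    HasDerivAt (fun s : ℝ => (NormedSpace.exp ((s : ℂ) • X)))
      (NormedSpace.exp ((t : ℂ) • X) * X : Matrix (Fin m) (Fin m) ℂ) t :=
  hasDerivAt_matrix.2 fun i j => (hasDerivAt_exp_entry X i j t).comp_ofReal

/-- The norm in force is the entrywise supremum, which is not submultiplicative in general, so the
product rule is taken entry by entry. -/
theorem hasDerivAt_matrix_mul {𝕜 : Type*} [NontriviallyNormedField 𝕜] [NormedAlgebra 𝕜 ℂ]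
    {a b : 𝕜 → Matrix (Fin m) (Fin m) ℂ} {a' b' : Matrix (Fin m) (Fin m) ℂ} {t : 𝕜}
    (ha : HasDerivAt (fun s => (a s)) (a') t)
    (hb : HasDerivAt (fun s => (b s)) (b') t) :
    HasDerivAt (fun s => (a s * b s))
      (a' * b t + a t * b' : Matrix (Fin m) (Fin m) ℂ) t := by
  refine hasDerivAt_matrix.2 fun i j => ?_
  have h : ∀ k, HasDerivAt (fun s => a s i k * b s k j) (a' i k * b t k j + a t i k * b' k j) t :=
    fun k => (hasDerivAt_matrix.1 ha i k).mul (hasDerivAt_matrix.1 hb k j)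
  have h2 := HasDerivAt.fun_sum (u := Finset.univ) fun k _ => h k
  simpa [Matrix.mul_apply, Finset.sum_add_distrib] using h2

/-- The adjoint action preserves the Lie algebra. -/
theorem conj_mem_lieAlg {K : Subgroup (GL (Fin m) ℂ)}
    (hK : IsZariskiClosed (K : Set (GL (Fin m) ℂ))) {X : Matrix (Fin m) (Fin m) ℂ}
    (hX : X ∈ lieAlg K) {g : GL (Fin m) ℂ} (hg : g ∈ K) :
    (g : Matrix (Fin m) (Fin m) ℂ) * X * ((g⁻¹ : GL (Fin m) ℂ) : Matrix (Fin m) (Fin m) ℂ)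
      ∈ lieAlg K := by
  refine isTangentAtOne_of_hasDerivAt (c := fun t : ℝ => g * expGL ((t : ℂ) • X) * g⁻¹)
    (fun t => K.mul_mem (K.mul_mem hg (expGL_mem hK ((lieAlg K).smul_mem _ hX))) (K.inv_mem hg))
    ?_ ?_
  · rw [mul_inv_eq_one]
    ext1
    simp
  · have hc : ∀ A : Matrix (Fin m) (Fin m) ℂ,
        HasDerivAt (fun _ : ℝ => (A)) (0 : Matrix (Fin m) (Fin m) ℂ) 0 :=
      fun A => hasDerivAt_const _ _
    have h := hasDerivAt_matrix_mul (hasDerivAt_matrix_mul (hc g) (hasDerivAt_real_exp_smul X 0))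
      (hc (g⁻¹ : GL (Fin m) ℂ))
    exact h.congr_deriv (by simp)

end MatrixFunctions

/-! ### The differential of a rational representation. -/

section Extension

variable {m : ℕ} {G : Subgroup (GL (Fin m) ℂ)}
  {V : Type*} [NormedAddCommGroup V] [NormedSpace ℂ V] [FiniteDimensional ℂ V]

/-- `F` is a holomorphic extension of `ρ` to a neighbourhood of `G` in the space of matrices. -/
structure IsExtension (ρ : Representation ℂ G V) (F : Matrix (Fin m) (Fin m) ℂ → V →L[ℂ] V) :
    Prop where
  contDiffAt : ∀ g : G, ContDiffAt ℂ ω F ((g : GL (Fin m) ℂ) : Matrix (Fin m) (Fin m) ℂ)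
  apply_eq : ∀ (g : G) (v : V), F ((g : GL (Fin m) ℂ) : Matrix (Fin m) (Fin m) ℂ) v = ρ g v

/-- In a basis, each matrix coefficient of `ρ` is a polynomial times a power of `det⁻¹`. This
formula makes sense for every matrix and is holomorphic where the determinant is not zero. With it
`ρ` can be differentiated without a manifold structure on `G`. -/
theorem IsRational.exists_isExtension {ρ : Representation ℂ G V} (hρ : IsRational ρ) :
    ∃ F, IsExtension ρ F := by
  let b := Module.finBasis ℂ V
  choose f k hfk using fun i j => hρ (b j) (b.coord i)
  let T : ∀ _ _ : Fin (Module.finrank ℂ V), V →L[ℂ] V := fun i j =>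
    LinearMap.toContinuousLinearMap ((b.coord j).smulRight (b i))
  refine ⟨fun A => ∑ i, ∑ j, (matEval A (f i j) *
    A.det⁻¹ ^ (k i j)) • T i j, fun g => ?_, fun g v => ?_⟩
  · refine ContDiffAt.sum fun i _ => ContDiffAt.sum fun j _ => ContDiffAt.fun_smul ?_ contDiffAt_const
    refine (contDiff_matEval (f i j)).contDiffAt.mul (ContDiffAt.pow ?_ _)
    refine contDiff_det.contDiffAt.inv ?_
    exact ((Matrix.isUnit_iff_isUnit_det _).1 (g : GL (Fin m) ℂ).isUnit).ne_zero
  · have h1 : ∀ i j, matEval ((g : GL (Fin m) ℂ) : Matrix (Fin m) (Fin m) ℂ) (f i j) *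
        (((g : GL (Fin m) ℂ) : Matrix (Fin m) (Fin m) ℂ).det)⁻¹ ^ (k i j) =
        b.coord i (ρ g (b j)) := fun i j => (hfk i j g).symm
    have h2 : ∀ w, ∑ i, b.coord i w • b i = w := fun w => b.sum_repr w
    rw [sum_apply, ← h2 (ρ g v)]
    refine Finset.sum_congr rfl fun i _ => ?_
    rw [sum_apply]
    conv_rhs => rw [← h2 v]
    simp only [map_sum, map_smul, Finset.sum_smul]
    refine Finset.sum_congr rfl fun j _ => ?_
    have h3 := h1 i j
    simp only [smul_apply, T]
    change (matEval ((g : GL (Fin m) ℂ) : Matrix (Fin m) (Fin m) ℂ) (f i j) *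
        (((g : GL (Fin m) ℂ) : Matrix (Fin m) (Fin m) ℂ).det)⁻¹ ^ (k i j)) •
        (b.coord j v • b i) = _
    rw [h3, smul_smul, smul_eq_mul, mul_comm]

namespace IsExtension

variable {ρ : Representation ℂ G V} {F : Matrix (Fin m) (Fin m) ℂ → V →L[ℂ] V}

theorem hasFDerivAt (hF : IsExtension ρ F) (g : G) :
    HasFDerivAt F (fderiv ℂ F ((g : GL (Fin m) ℂ) : Matrix (Fin m) (Fin m) ℂ))
      ((g : GL (Fin m) ℂ) : Matrix (Fin m) (Fin m) ℂ) :=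
  ((hF.contDiffAt g).differentiableAt (by simp)).hasFDerivAt

theorem hasDerivAt_exp_aux (hF : IsExtension ρ F)
    (hG : IsZariskiClosed (G : Set (GL (Fin m) ℂ))) (X : lieAlg G) (t : ℂ) :
    HasDerivAt (fun s : ℂ => F (NormedSpace.exp (s • (X : Matrix (Fin m) (Fin m) ℂ))))
      (fderiv ℂ F (NormedSpace.exp (t • (X : Matrix (Fin m) (Fin m) ℂ)))
        (NormedSpace.exp (t • (X : Matrix (Fin m) (Fin m) ℂ)) *
          (X : Matrix (Fin m) (Fin m) ℂ) : Matrix (Fin m) (Fin m) ℂ)) t :=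
  (hF.hasFDerivAt (expG hG (t • X))).comp_hasDerivAt t (hasDerivAt_exp_smul X.1 t)

/-- In directions tangent to `G` the derivative of the extension depends on `ρ` alone: compute it
along `exp (t X)`. -/
theorem fderiv_one (hF : IsExtension ρ F)
    (hG : IsZariskiClosed (G : Set (GL (Fin m) ℂ))) (hρ : IsRational ρ)
    (X : lieAlg G) (v : V) :
    fderiv ℂ F (1 : Matrix (Fin m) (Fin m) ℂ)
      (X : Matrix (Fin m) (Fin m) ℂ) v = dRep hG hρ X v := by
  have h := (hF.hasDerivAt_exp_aux hG X 0).clm_apply (hasDerivAt_const (0 : ℂ) v)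
  rw [dRep_apply]
  have h2 : (fun t : ℂ => ρ (expG hG (t • X)) v) =
      fun t : ℂ => F (NormedSpace.exp (t • (X : Matrix (Fin m) (Fin m) ℂ))) v := by
    ext t
    exact (hF.apply_eq (expG hG (t • X)) v).symm
  rw [h2, h.deriv]
  simp

theorem hasDerivAt_exp (hF : IsExtension ρ F)
    (hG : IsZariskiClosed (G : Set (GL (Fin m) ℂ))) (hρ : IsRational ρ)
    (X : lieAlg G) (v : V) :
    HasDerivAt (fun t : ℂ => ρ (expG hG (t • X)) v) (dRep hG hρ X v) 0 := by
  have h := (hF.hasDerivAt_exp_aux hG X 0).clm_apply (hasDerivAt_const (0 : ℂ) v)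
  have h2 : (fun t : ℂ => ρ (expG hG (t • X)) v) =
      fun t : ℂ => F (NormedSpace.exp (t • (X : Matrix (Fin m) (Fin m) ℂ))) v := by
    ext t
    exact (hF.apply_eq (expG hG (t • X)) v).symm
  rw [h2, ← hF.fderiv_one hG hρ]
  simpa using h

/-- The derivative of `ρ` at `g` in the direction `g X`. -/
theorem fderiv_mul (hF : IsExtension ρ F) (hG : IsZariskiClosed (G : Set (GL (Fin m) ℂ)))
    (hρ : IsRational ρ) (g : G) {A : Matrix (Fin m) (Fin m) ℂ} (hA : A = (g : GL (Fin m) ℂ))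
    (X : lieAlg G) (v : V) : fderiv ℂ F A (A * X.1) v = ρ g (dRep hG hρ X v) := by
  have hc : HasDerivAt (fun _ : ℂ => A) 0 0 := hasDerivAt_const _ _
  have h1 : HasDerivAt (fun t : ℂ => A * NormedSpace.exp (t • X.1)) (A * X.1) 0 :=
    (hasDerivAt_matrix_mul hc (hasDerivAt_exp_smul X.1 0)).congr_deriv (by simp)
  have h2 : HasFDerivAt F (fderiv ℂ F A) (A * NormedSpace.exp ((0 : ℂ) • X.1)) := by
    rw [zero_smul, NormedSpace.exp_zero, mul_one, hA]
    exact hF.hasFDerivAt g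
  have h3 : HasDerivAt (fun t : ℂ => F (A * NormedSpace.exp (t • X.1)))
    (fderiv ℂ F A (A * X.1)) 0 := h2.comp_hasDerivAt (0 : ℂ) h1
  have h4 := (LinearMap.toContinuousLinearMap (ρ g)).hasFDerivAt.comp_hasDerivAt (0 : ℂ)
    (hF.hasDerivAt_exp hG hρ X v)
  have h5 : (fun t : ℂ => F (A * NormedSpace.exp (t • X.1)) v) =
      (LinearMap.toContinuousLinearMap (ρ g)) ∘ fun t : ℂ => ρ (expG hG (t • X)) v := by
    ext t
    have h6 := hF.apply_eq (g * expG hG (t • X)) v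
    rw [map_mul, Module.End.mul_apply] at h6
    have h7 : A * NormedSpace.exp (t • X.1) =
        ((g * expG hG (t • X) : G) : GL (Fin m) ℂ) := by
      rw [hA]
      rfl
    rw [h7, h6]
    rfl
  have h6 : HasDerivAt (fun t : ℂ => F (A * NormedSpace.exp (t • X.1)) v)
      (fderiv ℂ F A (A * X.1) v) 0 := by
    simpa using h3.clm_apply (hasDerivAt_const (0 : ℂ) v)
  rw [h5] at h6
  exact h6.unique h4

end IsExtension

variable {ρ : Representation ℂ G V} (hG : IsZariskiClosed (G : Set (GL (Fin m) ℂ)))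
  (hρ : IsRational ρ)

theorem hasDerivAt_rho_exp (X : lieAlg G) (v : V) (t : ℂ) :
    HasDerivAt (fun t : ℂ => ρ (expG hG (t • X)) v) (ρ (expG hG (t • X)) (dRep hG hρ X v)) t := by
  obtain ⟨F, hF⟩ := hρ.exists_isExtension
  have h := (hF.hasDerivAt_exp_aux hG X t).clm_apply (hasDerivAt_const t v)
  have h2 : (fun t : ℂ => ρ (expG hG (t • X)) v) =
      fun t : ℂ => F (NormedSpace.exp (t • (X : Matrix (Fin m) (Fin m) ℂ))) v := by
    ext t
    exact (hF.apply_eq (expG hG (t • X)) v).symm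
  rw [h2, ← hF.fderiv_mul hG hρ (expG hG (t • X)) rfl]
  exact h.congr_deriv (by rw [map_zero, add_zero]; rfl)

/-- Here `Y = Ad(g) X`, so `exp (t Y) g = g exp (t X)`. Apply `ρ` and differentiate at `t = 0`. -/
theorem rho_dRep (g : G) (X Y : lieAlg G)
    (hY : (Y : Matrix (Fin m) (Fin m) ℂ) = ((g : GL (Fin m) ℂ) : Matrix (Fin m) (Fin m) ℂ) *
      (X : Matrix (Fin m) (Fin m) ℂ) *
      (((g⁻¹ : G) : GL (Fin m) ℂ) : Matrix (Fin m) (Fin m) ℂ)) (v : V) :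
    ρ g (dRep hG hρ X v) = dRep hG hρ Y (ρ g v) := by
  obtain ⟨F, hF⟩ := hρ.exists_isExtension
  have h1 := (LinearMap.toContinuousLinearMap (ρ g)).hasFDerivAt.comp_hasDerivAt (0 : ℂ)
    (hF.hasDerivAt_exp hG hρ X v)
  have h2 := hF.hasDerivAt_exp hG hρ Y (ρ g v)
  have h3 : ((LinearMap.toContinuousLinearMap (ρ g)) ∘ fun t : ℂ => ρ (expG hG (t • X)) v) =
      fun t : ℂ => ρ (expG hG (t • Y)) (ρ g v) := by
    ext t
    have h4 : expG hG (t • Y) * g = g * expG hG (t • X) := by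
      rw [← eq_mul_inv_iff_mul_eq]
      ext1; ext1
      have : ((t • Y : lieAlg G) : Matrix (Fin m) (Fin m) ℂ) =
          ((g : GL (Fin m) ℂ) : Matrix (Fin m) (Fin m) ℂ) *
          (t • (X : Matrix (Fin m) (Fin m) ℂ)) *
          (((g : GL (Fin m) ℂ)⁻¹ : GL (Fin m) ℂ) : Matrix (Fin m) (Fin m) ℂ) := by
        simp [hY]
      change NormedSpace.exp ((t • Y : lieAlg G) : Matrix (Fin m) (Fin m) ℂ) = _
      rw [this, Matrix.exp_units_conj]
      rfl
    change ρ g (ρ (expG hG (t • X)) v) = _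
    rw [← Module.End.mul_apply, ← Module.End.mul_apply, ← map_mul, ← map_mul, h4]
  rw [h3] at h1
  exact h1.unique h2

/-- Differentiate `ρ (exp tX) (Y · v) = (Ad (exp tX) Y) · ρ (exp tX) v` at `t = 0`. The left side
gives `X · (Y · v)`, and the product rule on the right gives `[X, Y] · v + Y · (X · v)`. -/
theorem dRep_lie (X Y : lieAlg G) : dRep hG hρ ⁅X, Y⁆ = ⁅dRep hG hρ X, dRep hG hρ Y⁆ := by
  obtain ⟨F, hF⟩ := hρ.exists_isExtension
  ext v
  let e : ℂ → Matrix (Fin m) (Fin m) ℂ := fun t => NormedSpace.exp (t • X.1)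
  let D := fderiv ℂ F (1 : Matrix (Fin m) (Fin m) ℂ)
  have he : HasDerivAt (fun t => (e t)) X.1 0 := by
    simpa using hasDerivAt_exp_smul X.1 0
  have he' : HasDerivAt (fun t : ℂ => (NormedSpace.exp (t • (-X.1)))) (-X.1) 0 := by
    simpa using hasDerivAt_exp_smul (-X.1) 0
  have hY : HasDerivAt (fun _ : ℂ => (Y.1))
      (0 : Matrix (Fin m) (Fin m) ℂ) 0 := hasDerivAt_const _ _
  have hconj := hasDerivAt_matrix_mul (hasDerivAt_matrix_mul he hY) he'
  have hval : ((X.1 * Y.1 + e 0 * 0) * NormedSpace.exp ((0 : ℂ) • (-X.1)) +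
      (e 0 * Y.1) * (-X.1) : Matrix (Fin m) (Fin m) ℂ) = (⁅X, Y⁆ : lieAlg G).1 := by
    simp [e, Ring.lie_def, sub_eq_add_neg]
  rw [hval] at hconj
  have h1 := (D.hasFDerivAt.comp_hasDerivAt (0 : ℂ) hconj).clm_apply
    (hF.hasDerivAt_exp hG hρ X v)
  have h2 := hF.hasDerivAt_exp hG hρ X (dRep hG hρ Y v)
  have h3 : (fun t : ℂ => ρ (expG hG (t • X)) (dRep hG hρ Y v)) = fun t : ℂ =>
      (D ∘ fun s : ℂ => ((e s * Y.1 * NormedSpace.exp (s • (-X.1)) :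
        Matrix (Fin m) (Fin m) ℂ))) t (ρ (expG hG (t • X)) v) := by
    ext t
    have hinv : NormedSpace.exp (t • (-X.1)) =
        ((((expG hG (t • X) : G) : GL (Fin m) ℂ)⁻¹ : GL (Fin m) ℂ) :
          Matrix (Fin m) (Fin m) ℂ) := by
      rw [smul_neg, Matrix.exp_neg, Matrix.coe_units_inv]
      rfl
    let Z : lieAlg G := ⟨_, conj_mem_lieAlg hG Y.2 (expG hG (t • X)).2⟩
    rw [rho_dRep hG hρ (expG hG (t • X)) Y Z rfl, ← hF.fderiv_one hG hρ Z]
    simp only [Function.comp_apply, hinv]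
    rfl
  rw [h3] at h2
  have h4 := h1.unique h2
  have h5 : D (⁅X, Y⁆ : lieAlg G).1 v + D Y.1 (dRep hG hρ X v) =
      dRep hG hρ X (dRep hG hρ Y v) := by
    have h6 : expG hG ((0 : ℂ) • X) = 1 := by
      ext1; ext1
      simp [expG]
    have h7 : e 0 * Y.1 * NormedSpace.exp ((0 : ℂ) • (-X.1)) = Y.1 := by simp [e]
    rw [← h4, Function.comp_apply, h7, h6, map_one, Module.End.one_apply]
    rfl
  rw [hF.fderiv_one hG hρ, hF.fderiv_one hG hρ] at h5
  rw [Ring.lie_def, LinearMap.sub_apply, Module.End.mul_apply, Module.End.mul_apply, ← h5]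
  abel

/-- The derivative of `t ↦ ρ (exp tX) y` is `ρ (exp tX) (X · y) = 0` at every `t`, so the curve
stays at `y`. -/
theorem expGL_mem_stabilizer {y : V} {X : lieAlg G} (hX : dRep hG hρ X y = 0) (t : ℂ) :
    expGL (t • (X : Matrix (Fin m) (Fin m) ℂ)) ∈ stabilizer ρ y := by
  refine ⟨expG hG (t • X), ?_, rfl⟩
  have hd : ∀ s, HasDerivAt (fun t : ℂ => ρ (expG hG (t • X)) y) 0 s := fun s => by
    simpa [hX] using hasDerivAt_rho_exp hG hρ X y s
  have h := is_const_of_deriv_eq_zero (fun s => (hd s).differentiableAt)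
    (fun s => (hd s).deriv) t 0
  change ρ (expG hG (t • X)) y = y
  rw [h]
  have : expG hG ((0 : ℂ) • X) = 1 := by
    ext1; ext1
    simp [expG]
  rw [this]
  simp

/-- The Lie algebra of the stabilizer is defined through the polynomials that vanish on the group,
and this identifies it with the annihilator of `y`. One direction tests tangency on the equations `φ
(ρ g y) = φ y`; the other uses the one-parameter group `exp (t X)`. -/
theorem mem_lieIn_stabilizer {y : V} {X : lieAlg G} :
    X ∈ lieIn G (stabilizer ρ y) ↔ dRep hG hρ X y = 0 := by
  constructor
  · intro hX
    obtain ⟨F, hF⟩ := hρ.exists_isExtension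
    rw [← Module.forall_dual_apply_eq_zero_iff ℂ]
    intro φ
    obtain ⟨f, k, hf⟩ := hρ y φ
    -- The equation `φ (ρ g y) = φ y` multiplied by `det ^ k`, which makes it polynomial in the
    -- entries.
    let p := f - MvPolynomial.C (φ y) *
      (Matrix.det (Matrix.mvPolynomialX (Fin m) (Fin m) ℂ)) ^ k
    have hdet : ∀ g : GL (Fin m) ℂ, (g : Matrix (Fin m) (Fin m) ℂ).det ≠ 0 := fun g =>
      ((Matrix.isUnit_iff_isUnit_det _).1 g.isUnit).ne_zero
    have hp : ∀ g : G, matEval ((g : GL (Fin m) ℂ) : Matrix (Fin m) (Fin m) ℂ) p =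
        (φ (ρ g y) - φ y) * ((g : GL (Fin m) ℂ) : Matrix (Fin m) (Fin m) ℂ).det ^ k := by
      intro g
      have h1 : matEval ((g : GL (Fin m) ℂ) : Matrix (Fin m) (Fin m) ℂ) p =
          matEval ((g : GL (Fin m) ℂ) : Matrix (Fin m) (Fin m) ℂ) f -
            φ y * ((g : GL (Fin m) ℂ) : Matrix (Fin m) (Fin m) ℂ).det ^ k := by
        simp only [p, map_sub, map_mul, map_pow, matEval_det]
        simp [matEval]
      rw [h1, hf g, sub_mul, mul_assoc, ← mul_pow, inv_mul_cancel₀ (hdet g), one_pow, mul_one]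
    have h0 : dirDeriv (X : Matrix (Fin m) (Fin m) ℂ) p = 0 := by
      refine hX p ?_
      rintro _ ⟨g, hg, rfl⟩
      have hg' : ρ g y = y := hg
      rw [Subgroup.coe_subtype, hp, hg']
      simp
    have h1 := hasDerivAt_matEval_exp X.1 p 0
    rw [zero_smul, NormedSpace.exp_zero, ← dirDeriv_eq, h0] at h1
    have h2 := (LinearMap.toContinuousLinearMap φ).hasFDerivAt.comp_hasDerivAt (0 : ℂ)
      (hF.hasDerivAt_exp hG hρ X y)
    have h3 := hasDerivAt_matEval_exp X.1
      (Matrix.det (Matrix.mvPolynomialX (Fin m) (Fin m) ℂ) ^ k) 0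
    have h4 := (h2.sub_const (φ y)).mul h3
    have h5 : (fun s : ℂ => matEval (NormedSpace.exp (s • X.1)) p) = fun s : ℂ =>
        (((LinearMap.toContinuousLinearMap φ) ∘ fun t : ℂ => ρ (expG hG (t • X)) y) s - φ y) *
        matEval (NormedSpace.exp (s • X.1))
          (Matrix.det (Matrix.mvPolynomialX (Fin m) (Fin m) ℂ) ^ k) := by
      ext s
      rw [map_pow, matEval_det]
      exact hp (expG hG (s • X))
    rw [h5] at h1
    -- At `t = 0` the first factor `φ (ρ g y) - φ y` vanishes and the determinant is `1`, so the
    -- product rule leaves only `φ (X · y)`.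
    have h6 := h4.unique h1
    have h7 : expG hG (0 : lieAlg G) = 1 := by
      ext1; ext1
      simp [expG]
    simpa [h7, matEval_det] using h6
  · intro hX
    refine isTangentAtOne_of_hasDerivAt
      (c := fun t : ℝ => expGL ((t : ℂ) • (X : Matrix (Fin m) (Fin m) ℂ)))
      (fun t => expGL_mem_stabilizer hG hρ hX t) ?_ ?_
    · ext1
      simp
    · refine (hasDerivAt_real_exp_smul X.1 0).congr_deriv ?_
      rw [Complex.ofReal_zero, zero_smul, NormedSpace.exp_zero, one_mul]
      rfl

/-- A subspace that is invariant under a closed subgroup is invariant under its Lie algebra. -/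
theorem dRep_mem_of_invariant {R : Subgroup (GL (Fin m) ℂ)}
    (hR : IsZariskiClosed (R : Set (GL (Fin m) ℂ))) {N : Submodule ℂ V}
    (hN : ∀ r : G, (r : GL (Fin m) ℂ) ∈ R → ∀ n ∈ N, ρ r n ∈ N)
    {X : lieAlg G} (hX : X ∈ lieIn G R) {n : V} (hn : n ∈ N) : dRep hG hρ X n ∈ N := by
  obtain ⟨F, hF⟩ := hρ.exists_isExtension
  have h := hF.hasDerivAt_exp hG hρ X n
  rw [hasDerivAt_iff_tendsto_slope] at h
  -- The difference quotients of `t ↦ ρ (exp tX) n` lie in `N`, which is closed, so their limit does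
  -- too.
  refine N.closed_of_finiteDimensional.mem_of_tendsto h (Filter.Eventually.of_forall fun t => ?_)
  rw [slope_def_module]
  exact N.smul_mem _ (N.sub_mem
    (hN _ (expGL_mem hR ((lieAlg R).smul_mem _ hX)) n hn)
    (hN _ (expGL_mem hR ((lieAlg R).smul_mem _ hX)) n hn))

end Extension

end MatrixAnalysis

/-! ### One-parameter groups and the Lie algebra of a semidirect product. -/

/-- A continuous one-parameter family in a Banach algebra with `c (s + t) = c s * c t` is
differentiable. -/
theorem exists_hasDerivAt_of_map_add {A : Type*} [NormedRing A] [NormedAlgebra ℝ A]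
    [CompleteSpace A] {c : ℝ → A} (hc : Continuous c) (h0 : c 0 = 1)
    (hadd : ∀ s t, c (s + t) = c s * c t) : ∃ Y, HasDerivAt c Y 0 := by
  -- Integrating the functional equation gives `c t * I a = I (t + a) - I t`. If `I a` is a unit,
  -- this writes `c` through the differentiable function `I`.
  let I : ℝ → A := fun t => ∫ s in (0 : ℝ)..t, c s
  have hI : ∀ t, HasDerivAt I (c t) t := fun t =>
    intervalIntegral.integral_hasDerivAt_right (hc.intervalIntegrable _ _)
      (hc.stronglyMeasurableAtFilter _ _) hc.continuousAt
  -- `I a / a` tends to `c 0 = 1` as `a → 0`, and the units are open.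
  obtain ⟨a, ha⟩ : ∃ a : ℝ, IsUnit (I a) := by
    have h := hI 0
    rw [hasDerivAt_iff_tendsto_slope, h0] at h
    obtain ⟨a, hau, ha0⟩ := ((h.eventually (Units.isOpen.mem_nhds isUnit_one)).and
      self_mem_nhdsWithin).exists
    refine ⟨a, ?_⟩
    have h1 : slope I 0 a = a⁻¹ • I a := by
      simp [slope_def_module, I]
    have ha0' : a ≠ 0 := ha0
    replace hau : IsUnit (slope I 0 a) := hau
    rw [h1] at hau
    have h2 := hau.smul (Units.mk0 a ha0')
    simpa [Units.smul_def, smul_smul, ha0'] using h2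
  obtain ⟨u, hu⟩ := ha
  have h1 : ∀ t, c t = (I (t + a) - I t) * (↑u⁻¹ : A) := by
    intro t
    rw [Units.eq_mul_inv_iff_mul_eq, hu, intervalIntegral.integral_interval_sub_left
      (hc.intervalIntegrable _ _) (hc.intervalIntegrable _ _)]
    have h2 : c t * I a = ∫ s in (0 : ℝ)..a, c t * c s :=
      ((ContinuousLinearMap.mul ℝ A (c t)).intervalIntegral_comp_comm
        (hc.intervalIntegrable 0 a)).symm
    simp only [← hadd] at h2
    rw [h2, intervalIntegral.integral_comp_add_left, add_zero]

  have h2 : HasDerivAt (fun t => (I (t + a) - I t) * (↑u⁻¹ : A))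
      ((c (0 + a) - c 0) * (↑u⁻¹ : A)) 0 :=
    (((hI (0 + a)).comp_add_const 0 a).sub (hI 0)).mul_const _
  exact ⟨_, by rwa [← funext h1] at h2⟩

section Levi

variable {m : ℕ}

theorem continuous_coe_GL :
    Continuous (fun g : GL (Fin m) ℂ => (g : Matrix (Fin m) (Fin m) ℂ)) :=
  Units.continuous_val

/-- A continuous one-parameter group of matrices is differentiable. -/
theorem exists_hasDerivAt_GL {c : ℝ → GL (Fin m) ℂ} (hc : Continuous c) (h0 : c 0 = 1)
    (hadd : ∀ s t, c (s + t) = c s * c t) :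
    ∃ Y : Matrix (Fin m) (Fin m) ℂ,
      HasDerivAt (fun t => (c t : Matrix (Fin m) (Fin m) ℂ)) Y 0 := by
  let _ : NormedRing (Matrix (Fin m) (Fin m) ℂ) := Matrix.linftyOpNormedRing
  let _ : NormedAlgebra ℝ (Matrix (Fin m) (Fin m) ℂ) := Matrix.linftyOpNormedAlgebra
  exact exists_hasDerivAt_of_map_add (c := fun t => (c t : Matrix (Fin m) (Fin m) ℂ))
    (continuous_coe_GL.comp hc) (by simp [h0]) (by simp [hadd])

attribute [local instance] Matrix.normedAddCommGroup Matrix.normedSpace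

theorem IsZariskiClosed.isClosed {Z : Set (GL (Fin m) ℂ)} (hZ : IsZariskiClosed Z) :
    IsClosed Z := by
  obtain ⟨P, rfl⟩ := hZ
  have h : {g : GL (Fin m) ℂ | ∀ f ∈ P, matEval (g : Matrix (Fin m) (Fin m) ℂ) f = 0} =
      ⋂ f ∈ P, {g : GL (Fin m) ℂ | matEval (g : Matrix (Fin m) (Fin m) ℂ) f = 0} := by
    ext g
    simp
  rw [h]
  exact isClosed_biInter fun f _ =>
    isClosed_eq ((differentiable_matEval f).continuous.comp continuous_coe_GL) continuous_const

/-- By `g ↦ (g, g⁻¹)` the group is a closed subset of a finite-dimensional space. This is needed for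
the open mapping theorem for σ-compact groups. -/
instance : SigmaCompactSpace (GL (Fin m) ℂ) :=
  haveI : SigmaCompactSpace (Matrix (Fin m) (Fin m) ℂ) :=
    inferInstanceAs (SigmaCompactSpace (Fin m → Fin m → ℂ))
  haveI : SigmaCompactSpace (Matrix (Fin m) (Fin m) ℂ)ᵐᵒᵖ :=
    MulOpposite.opHomeomorph.symm.isClosedEmbedding.sigmaCompactSpace
  Units.isClosedEmbedding_embedProduct.sigmaCompactSpace

theorem expGL_zero : expGL (0 : Matrix (Fin m) (Fin m) ℂ) = 1 := by
  ext1
  simp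

theorem expGL_add_smul (X : Matrix (Fin m) (Fin m) ℂ) (s t : ℝ) :
    expGL (((s + t : ℝ) : ℂ) • X) = expGL ((s : ℂ) • X) * expGL ((t : ℂ) • X) := by
  ext1
  rw [Units.val_mul, coe_expGL, coe_expGL, coe_expGL, Complex.ofReal_add, add_smul]
  exact Matrix.exp_add_of_commute _ _
    (((Commute.refl X).smul_left _).smul_right _)

theorem continuous_expGL_smul (X : Matrix (Fin m) (Fin m) ℂ) :
    Continuous (fun t : ℝ => expGL ((t : ℂ) • X)) := by
  have h : ∀ Y : Matrix (Fin m) (Fin m) ℂ,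
      Continuous (fun t : ℝ => NormedSpace.exp ((t : ℂ) • Y)) := fun Y =>
    continuous_iff_continuousAt.2 fun t => (hasDerivAt_real_exp_smul Y t).continuousAt
  rw [Units.continuous_iff]
  refine ⟨h X, ?_⟩
  convert h (-X) using 2 with t
  rw [smul_neg, Matrix.exp_neg, Matrix.coe_units_inv]
  rfl

/-- The Lie algebra of a semidirect product is the sum of the Lie algebras of the factors. -/
theorem exists_add_of_semidirect {H R Q : Subgroup (GL (Fin m) ℂ)}
    (hR : IsClosed (R : Set (GL (Fin m) ℂ))) (hQ : IsClosed (Q : Set (GL (Fin m) ℂ)))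
    (hRH : R ≤ H) (hnormal : ∀ k ∈ H, ∀ u ∈ Q, k * u * k⁻¹ ∈ Q) (hdisj : R ⊓ Q = ⊥)
    (hmul : ∀ h ∈ H, ∃ r ∈ R, ∃ q ∈ Q, h = r * q) {X : Matrix (Fin m) (Fin m) ℂ}
    (hX : ∀ t : ℝ, expGL ((t : ℂ) • X) ∈ H) :
    ∃ Y ∈ lieAlg R, ∃ Z ∈ lieAlg Q, X = Y + Z := by
  let e : ℝ → GL (Fin m) ℂ := fun t => expGL ((t : ℂ) • X)
  have he : Continuous e := continuous_expGL_smul X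
  have hadd : ∀ s t, e (s + t) = e s * e t := expGL_add_smul X
  have he0 : e 0 = 1 := by simp [e, expGL_zero]
  -- `Γ` is the graph of `t ↦` the `R`-component of `exp (t X)`. It is closed under products because
  -- `Q` is normal, so the component is a homomorphism in `t`.
  let Γ : Subgroup (Multiplicative ℝ × GL (Fin m) ℂ) :=
    { carrier := {p | p.2 ∈ R ∧ p.2⁻¹ * e p.1.toAdd ∈ Q}
      one_mem' := ⟨R.one_mem, by simp [he0]⟩
      mul_mem' := by
        rintro ⟨s, r⟩ ⟨t, r'⟩ ⟨h1, h2⟩ ⟨h3, h4⟩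
        refine ⟨R.mul_mem h1 h3, ?_⟩
        change (r * r')⁻¹ * e (s.toAdd + t.toAdd) ∈ Q
        rw [hadd]
        have h5 := hnormal _ (H.inv_mem (hRH h3)) _ h2
        convert Q.mul_mem h5 h4 using 1
        group
      inv_mem' := by
        rintro ⟨s, r⟩ ⟨h1, h2⟩
        refine ⟨R.inv_mem h1, ?_⟩
        change (r⁻¹)⁻¹ * e (-s.toAdd) ∈ Q
        have h3 : e (-s.toAdd) = (e s.toAdd)⁻¹ := by
          rw [eq_inv_iff_mul_eq_one, ← hadd, neg_add_cancel, he0]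
        have h4 := hnormal _ (hRH h1) _ (Q.inv_mem h2)
        rw [h3]
        convert h4 using 1
        change _ = r * (r⁻¹ * e s.toAdd)⁻¹ * r⁻¹
        group }
  have hΓ : IsClosed (Γ : Set (Multiplicative ℝ × GL (Fin m) ℂ)) := by
    refine (hR.preimage continuous_snd).inter (hQ.preimage ?_)
    exact continuous_snd.inv.mul (he.comp (continuous_toAdd.comp continuous_fst))
  have : SigmaCompactSpace (Multiplicative ℝ) := inferInstanceAs (SigmaCompactSpace ℝ)
  have : LocallyCompactSpace (Multiplicative ℝ) := inferInstanceAs (LocallyCompactSpace ℝ)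
  have : SigmaCompactSpace Γ := hΓ.sigmaCompactSpace
  let π : Γ →* Multiplicative ℝ := (MonoidHom.fst _ _).comp Γ.subtype
  have hπc : Continuous π := continuous_fst.comp continuous_subtype_val
  have hsurj : Function.Surjective π := by
    intro t
    obtain ⟨r, hr, q, hq, hrq⟩ := hmul _ (hX t.toAdd)
    refine ⟨⟨(t, r), hr, ?_⟩, rfl⟩
    change r⁻¹ * expGL _ ∈ Q
    rw [hrq]
    simpa using hq
  have hinj : Function.Injective π := by
    rw [injective_iff_map_eq_one]
    rintro ⟨⟨t, r⟩, h1, h2⟩ (rfl : t = 1)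
    have h3 : r ∈ R ⊓ Q := ⟨h1, by
      have h4 : r⁻¹ * e 0 ∈ Q := h2
      simpa [he0] using h4⟩
    rw [hdisj, Subgroup.mem_bot] at h3
    subst h3
    rfl
  -- A continuous surjective homomorphism from a σ-compact group onto `ℝ` is open. This is what
  -- makes the `R`-component `c` of `exp (t X)` continuous, hence differentiable.
  have hopen : IsOpenMap π := π.isOpenMap_of_sigmaCompact hsurj hπc
  let E : Γ ≃* Multiplicative ℝ := MulEquiv.ofBijective π ⟨hinj, hsurj⟩
  have hE : Continuous E.symm :=
    (E.toEquiv.toHomeomorphOfContinuousOpen hπc hopen).symm.continuous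
  let c : ℝ → GL (Fin m) ℂ := fun t => (E.symm (Multiplicative.ofAdd t)).1.2
  have hcc : Continuous c := continuous_snd.comp (continuous_subtype_val.comp
    (hE.comp continuous_ofAdd))
  have hcR : ∀ t, c t ∈ R := fun t => (E.symm (Multiplicative.ofAdd t)).2.1
  have hcQ : ∀ t, (c t)⁻¹ * e t ∈ Q := fun t => by
    have h1 := (E.symm (Multiplicative.ofAdd t)).2.2
    have h2 : (E.symm (Multiplicative.ofAdd t)).1.1 = Multiplicative.ofAdd t :=
      E.apply_symm_apply _
    rw [h2] at h1
    exact h1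
  have hc0 : c 0 = 1 := by
    simp only [c, ofAdd_zero, map_one]
    rfl
  have hcadd : ∀ s t, c (s + t) = c s * c t := fun s t => by
    simp only [c, ofAdd_add, map_mul]
    rfl
  obtain ⟨Y, hY⟩ := exists_hasDerivAt_GL hcc hc0 hcadd
  have hneg : ∀ t, c (-t) = (c t)⁻¹ := fun t => by
    rw [eq_inv_iff_mul_eq_one, ← hcadd, neg_add_cancel, hc0]
  -- `Y` is the velocity at `0` of the curve `c` in `R`, and `X - Y` that of the curve `c⁻¹ exp (t
  -- X)` in `Q`.
  refine ⟨Y, isTangentAtOne_of_hasDerivAt hcR hc0 hY, X - Y,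
    isTangentAtOne_of_hasDerivAt hcQ (by simp [hc0, he0]) ?_, by abel⟩
  have h1 : HasDerivAt (fun t => (c (-t) : Matrix (Fin m) (Fin m) ℂ)) (-Y) 0 := by
    have h2 : HasDerivAt (fun t => (c t : Matrix (Fin m) (Fin m) ℂ)) Y (-(0 : ℝ)) := by
      rwa [neg_zero]
    refine hasDerivAt_matrix.2 fun i j => ?_
    exact ((hasDerivAt_matrix.1 h2 i j).scomp (0 : ℝ) (hasDerivAt_neg (0 : ℝ))).congr_deriv (by simp)
  have h3 := hasDerivAt_matrix_mul h1 (hasDerivAt_real_exp_smul X 0)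
  have h4 : (fun t => (((c t)⁻¹ * e t : GL (Fin m) ℂ) : Matrix (Fin m) (Fin m) ℂ)) =
      fun t => (c (-t) : Matrix (Fin m) (Fin m) ℂ) * NormedSpace.exp ((t : ℂ) • X) := by
    ext1 t
    rw [hneg]
    rfl
  rw [h4]
  exact h3.congr_deriv (by simp [hc0, sub_eq_neg_add])

/-- `exp (t X)` lies in `R ⊓ Q` and so is `1` for every `t`; its derivative at `0` is `X`. -/
theorem lieAlg_inf_eq_zero {R Q : Subgroup (GL (Fin m) ℂ)}
    (hR : IsZariskiClosed (R : Set (GL (Fin m) ℂ))) (hQ : IsZariskiClosed (Q : Set (GL (Fin m) ℂ)))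
    (hdisj : R ⊓ Q = ⊥) {X : Matrix (Fin m) (Fin m) ℂ} (hXR : X ∈ lieAlg R)
    (hXQ : X ∈ lieAlg Q) : X = 0 := by
  have h1 : ∀ t : ℂ, NormedSpace.exp (t • X) = 1 := fun t => by
    have h2 : expGL (t • X) ∈ R ⊓ Q :=
      ⟨expGL_mem hR ((lieAlg R).smul_mem t hXR), expGL_mem hQ ((lieAlg Q).smul_mem t hXQ)⟩
    rw [hdisj, Subgroup.mem_bot] at h2
    rw [← coe_expGL, h2, Units.val_one]
  have h3 := hasDerivAt_exp_smul X 0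
  simp only [h1, one_mul] at h3
  exact h3.unique (hasDerivAt_const _ _)

variable {G : Subgroup (GL (Fin m) ℂ)}
  {V : Type*} [NormedAddCommGroup V] [NormedSpace ℂ V]

theorem stabilizer_le (ρ : Representation ℂ G V) (y : V) : stabilizer ρ y ≤ G := by
  rintro _ ⟨g, -, rfl⟩
  exact g.2

/-- The Lie algebra of a stabilizer is the direct sum of the Lie algebras of its Levi factors. -/
theorem IsLeviDecomposition.exists_add [FiniteDimensional ℂ V]
    (hG : IsZariskiClosed (G : Set (GL (Fin m) ℂ))) {ρ : Representation ℂ G V}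
    (hρ : IsRational ρ) {x : V} {R Q : Subgroup (GL (Fin m) ℂ)}
    (hLevi : IsLeviDecomposition (stabilizer ρ x) R Q) {X : lieAlg G}
    (hX : X ∈ lieIn G (stabilizer ρ x)) :
    ∃ r ∈ lieIn G R, ∃ q ∈ lieIn G Q, X = r + q := by
  have h0 := (mem_lieIn_stabilizer hG hρ).1 hX
  obtain ⟨Y, hY, Z, hZ, hYZ⟩ := exists_add_of_semidirect hLevi.reductive.closed.isClosed
    hLevi.radical.closed.isClosed hLevi.le hLevi.radical.normal hLevi.disjoint hLevi.mul_eq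
    fun t => expGL_mem_stabilizer hG hρ h0 t
  have hRG : R ≤ G := hLevi.le.trans (stabilizer_le ρ x)
  have hQG : Q ≤ G := hLevi.radical.le.trans (stabilizer_le ρ x)
  exact ⟨⟨Y, lieAlg_mono hRG hY⟩, hY, ⟨Z, lieAlg_mono hQG hZ⟩, hZ, Subtype.ext hYZ⟩

end Levi

/-! ### The holomorphic inverse function theorem on a manifold. -/

section InverseFunction

variable {E : Type*} [NormedAddCommGroup E] [NormedSpace ℂ E] [CompleteSpace E]
  {B : Type*} [TopologicalSpace B] {I : ModelWithCorners ℂ E B} [I.Boundaryless]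
  {X : Type*} [TopologicalSpace X] [ChartedSpace B X] [IsManifold I ω X]
  {V : Type*} [NormedAddCommGroup V] [NormedSpace ℂ V]

/-- The holomorphic inverse function theorem on manifolds. -/
theorem exists_openPartialHomeomorph_of_mfderiv {f : X → V} {p : X} {A : E ≃L[ℂ] V}
    (hf : ContMDiff I 𝓘(ℂ, V) ω f) (hA : HasMFDerivAt I 𝓘(ℂ, V) f p (A : E →L[ℂ] V)) :
    ∃ Φ : OpenPartialHomeomorph X V, p ∈ Φ.source ∧ (∀ q ∈ Φ.source, Φ q = f q) ∧
      ContMDiffOn 𝓘(ℂ, V) I ω Φ.symm Φ.target := by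
  let z := extChartAt I p p
  let g : E → V := f ∘ (extChartAt I p).symm
  have hgA : HasFDerivAt g (A : E →L[ℂ] V) z := by
    have h : HasFDerivWithinAt g (A : E →L[ℂ] V) (Set.range I) z := hA.2
    rw [I.range_eq_univ, hasFDerivWithinAt_univ] at h
    exact h
  have hg : ContDiffAt ℂ ω g z := by
    rw [← contMDiffAt_iff_contDiffAt]
    refine hf.contMDiffAt.comp z ?_
    exact (contMDiffOn_extChartAt_symm p).contMDiffAt (extChartAt_target_mem_nhds p)
  let ψ := hg.toOpenPartialHomeomorph g hgA (by simp)
  have hψ : ContDiffAt ℂ ω ψ.symm (g z) := hg.to_localInverse hgA (by simp)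
  -- The inverse function theorem gives analyticity of the local inverse at one point only.
  -- Analyticity is an open condition, so it persists on a neighbourhood `W`, to which the target is
  -- restricted below.
  obtain ⟨W, hW, hWo, hzW⟩ := mem_nhds_iff.1 (hψ.eventually (by simp))
  let φ : OpenPartialHomeomorph X E := (chartAt B p).trans I.toHomeomorph.toOpenPartialHomeomorph
  have hφ : ∀ q ∈ φ.source, (extChartAt I p).symm (φ q) = q := fun q hq =>
    (extChartAt I p).left_inv (by
      rw [extChartAt_source]
      exact hq.1)
  have hφt : φ.target ⊆ (extChartAt I p).target := by
    intro y hy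
    rw [extChartAt_target]
    exact ⟨hy.2, ⟨I.symm y, I.right_inv (I.range_eq_univ ▸ Set.mem_univ y)⟩⟩
  have hpφ : p ∈ φ.source := ⟨mem_chart_source B p, Set.mem_univ _⟩
  have hzψ : z ∈ ψ.source := hg.mem_toOpenPartialHomeomorph_source hgA (by simp)
  let Φ₀ := φ.trans ψ
  have hΦ₀ : ∀ q ∈ Φ₀.source, Φ₀ q = f q := fun q hq => congrArg f (hφ q hq.1)
  have hp₀ : p ∈ Φ₀.source := ⟨hpφ, hzψ⟩
  refine ⟨(Φ₀.symm.restrOpen W hWo).symm, ?_, ?_, ?_⟩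
  · change p ∈ (Φ₀.symm.restrOpen W hWo).target
    have h1 : Φ₀ p ∈ (Φ₀.symm.restrOpen W hWo).source := ⟨Φ₀.map_source hp₀, hzW⟩
    have h2 := (Φ₀.symm.restrOpen W hWo).map_source h1
    have h3 : (Φ₀.symm.restrOpen W hWo) (Φ₀ p) = p := Φ₀.left_inv hp₀
    rwa [h3] at h2
  · intro q hq
    exact hΦ₀ q hq.1
  · intro y hy
    obtain ⟨hy1, hy2⟩ : y ∈ Φ₀.target ∧ y ∈ W := hy
    have h1 : ContMDiffAt 𝓘(ℂ, V) 𝓘(ℂ, E) ω ψ.symm y :=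
      ContDiffAt.contMDiffAt (hW hy2 :)
    have h2 : ContMDiffAt 𝓘(ℂ, E) I ω (extChartAt I p).symm (ψ.symm y) := by
      have h3 := hφt hy1.2
      exact (contMDiffOn_extChartAt_symm p).contMDiffAt
        ((isOpen_extChartAt_target p).mem_nhds h3)
    exact (h2.comp y h1).contMDiffWithinAt

end InverseFunction

/-! ### Holomorphy and derivative of `mu`. -/

section Mu

variable {m : ℕ} {G : Subgroup (GL (Fin m) ℂ)}
  {V : Type*} [NormedAddCommGroup V] [NormedSpace ℂ V] [FiniteDimensional ℂ V]
  {ρ : Representation ℂ G V} {x : V} {N : Submodule ℂ V}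
  {d : ℕ} {M : Set G} [ChartedSpace (EuclideanSpace ℂ (Fin d)) M]

section

attribute [local instance] Matrix.normedAddCommGroup Matrix.normedSpace

variable {F : Matrix (Fin m) (Fin m) ℂ → V →L[ℂ] V}

/-- The extension of a representation as a function of families of matrix entries. -/
theorem IsExtension.contDiffAt_entries (hF : IsExtension ρ F) (g : G) :
    ContDiffAt ℂ ω (fun A : Fin m → Fin m → ℂ => F (Matrix.of A))
      (fun i j => ((g : GL (Fin m) ℂ) : Matrix (Fin m) (Fin m) ℂ) i j) :=
  hF.contDiffAt g

theorem IsExtension.fderiv_entries (hF : IsExtension ρ F)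
    (hG : IsZariskiClosed (G : Set (GL (Fin m) ℂ))) (hρ : IsRational ρ) (g : G) (X : lieAlg G)
    (v : V) {C : Fin m → Fin m → ℂ}
    (hC : Matrix.of C = ((g : GL (Fin m) ℂ) : Matrix (Fin m) (Fin m) ℂ) * X.1) :
    fderiv ℂ (fun A : Fin m → Fin m → ℂ => F (Matrix.of A))
      (fun i j => ((g : GL (Fin m) ℂ) : Matrix (Fin m) (Fin m) ℂ) i j) C v =
      ρ g (dRep hG hρ X v) := by
  rw [← hF.fderiv_mul hG hρ g rfl X v, ← hC]
  rfl

end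

/-- The extension in the form used for `toMat`: a function of families of entries, whose norm is the
product norm, with no norm chosen on matrices. -/
theorem exists_entries_extension (hG : IsZariskiClosed (G : Set (GL (Fin m) ℂ)))
    (hρ : IsRational ρ) : ∃ F : (Fin m → Fin m → ℂ) → V →L[ℂ] V,
      (∀ g : G, ContDiffAt ℂ ω F
        (fun i j => ((g : GL (Fin m) ℂ) : Matrix (Fin m) (Fin m) ℂ) i j)) ∧
      (∀ (g : G) (v : V),
        F (fun i j => ((g : GL (Fin m) ℂ) : Matrix (Fin m) (Fin m) ℂ) i j) v = ρ g v) ∧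
      ∀ (g : G) (X : lieAlg G) (v : V) (C : Fin m → Fin m → ℂ),
        Matrix.of C = ((g : GL (Fin m) ℂ) : Matrix (Fin m) (Fin m) ℂ) * X.1 →
        fderiv ℂ F (fun i j => ((g : GL (Fin m) ℂ) : Matrix (Fin m) (Fin m) ℂ) i j) C v =
          ρ g (dRep hG hρ X v) := by
  obtain ⟨F, hF⟩ := hρ.exists_isExtension
  exact ⟨fun A => F (Matrix.of A), hF.contDiffAt_entries, hF.apply_eq,
    fun g X v C hC => hF.fderiv_entries hG hρ g X v hC⟩

/-- The map `μ` is holomorphic. -/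
theorem contMDiff_mu (hρ : IsRational ρ) (hG : IsZariskiClosed (G : Set (GL (Fin m) ℂ)))
    (hM : ContMDiff 𝓘(ℂ, EuclideanSpace ℂ (Fin d)) 𝓘(ℂ, Fin m → Fin m → ℂ) ω (toMat M)) :
    ContMDiff (𝓘(ℂ, EuclideanSpace ℂ (Fin d)).prod 𝓘(ℂ, N)) 𝓘(ℂ, V) ω (mu ρ x M N) := by
  obtain ⟨F, hF1, hF2, -⟩ := exists_entries_extension hG hρ
  have h : mu ρ x M N = fun p => F (toMat M p.1) (x + (p.2 : V)) := by
    ext p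
    exact (hF2 p.1 _).symm
  rw [h]
  refine ContMDiff.clm_apply (fun p => ?_) ?_
  · have h1 : ContMDiffAt 𝓘(ℂ, Fin m → Fin m → ℂ) 𝓘(ℂ, V →L[ℂ] V) ω F (toMat M p.1) :=
      (hF1 p.1).contMDiffAt
    exact h1.comp p ((hM.comp contMDiff_fst).contMDiffAt)
  · exact contMDiff_const.add (N.subtypeL.contMDiff.comp contMDiff_snd)

/-- The derivative of `μ` at `(p, n)`, in a direction `(w, u)` with `w = p X`. -/
theorem mfderiv_mu (hρ : IsRational ρ) (hG : IsZariskiClosed (G : Set (GL (Fin m) ℂ)))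
    (hM : ContMDiff 𝓘(ℂ, EuclideanSpace ℂ (Fin d)) 𝓘(ℂ, Fin m → Fin m → ℂ) ω (toMat M))
    (p : M) (n : N) (w : TangentSpace 𝓘(ℂ, EuclideanSpace ℂ (Fin d)) p) (u : N) (X : lieAlg G)
    (hX : dToMat d M p w = Matrix.of (toMat M p) * X.1) :
    mfderiv (𝓘(ℂ, EuclideanSpace ℂ (Fin d)).prod 𝓘(ℂ, N)) 𝓘(ℂ, V) (mu ρ x M N) (p, n) (w, u) =
      ρ p (dRep hG hρ X (x + (n : V)) + u) := by
  obtain ⟨F, hF1, hF2, hF3⟩ := exists_entries_extension hG hρ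
  have h : mu ρ x M N = (fun q : (Fin m → Fin m → ℂ) × N => F q.1 (x + (q.2 : V))) ∘
      fun p : M × N => (toMat M p.1, p.2) := by
    ext p
    exact (hF2 p.1 _).symm
  have h1 : HasMFDerivAt (𝓘(ℂ, EuclideanSpace ℂ (Fin d)).prod 𝓘(ℂ, N))
      𝓘(ℂ, Fin m → Fin m → ℂ) (fun p : M × N => toMat M p.1) (p, n)
      ((mfderiv 𝓘(ℂ, EuclideanSpace ℂ (Fin d)) 𝓘(ℂ, Fin m → Fin m → ℂ) (toMat M) p).comp
        (ContinuousLinearMap.fst ℂ (TangentSpace 𝓘(ℂ, EuclideanSpace ℂ (Fin d)) p)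
          (TangentSpace 𝓘(ℂ, N) n))) :=
    HasMFDerivAt.comp (p, n) ((hM.mdifferentiableAt (by simp)).hasMFDerivAt)
      (hasMFDerivAt_fst (p, n))
  have h1' : HasMFDerivAt (𝓘(ℂ, EuclideanSpace ℂ (Fin d)).prod 𝓘(ℂ, N)) 𝓘(ℂ, N)
      (fun p : M × N => p.2) (p, n) _ := hasMFDerivAt_snd (p, n)
  have h2 : HasMFDerivAt (𝓘(ℂ, EuclideanSpace ℂ (Fin d)).prod 𝓘(ℂ, N))
      𝓘(ℂ, (Fin m → Fin m → ℂ) × N) (fun p : M × N => (toMat M p.1, p.2)) (p, n) _ :=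
    ⟨h1.1.prodMk h1'.1, h1.2.prodMk h1'.2⟩
  have h3 : HasFDerivAt (fun q : (Fin m → Fin m → ℂ) × N => F q.1 (x + (q.2 : V)))
      _ (toMat M p, n) :=
    HasFDerivAt.clm_apply
      ((((hF1 p).differentiableAt (by simp)).hasFDerivAt).comp (toMat M p, n) hasFDerivAt_fst)
      ((N.subtypeL.hasFDerivAt.comp (toMat M p, n) hasFDerivAt_snd).const_add x)
  have h4 := HasMFDerivAt.comp (p, n) h3.hasMFDerivAt h2
  rw [h, h4.mfderiv]
  have h5 := hF3 p X (x + (n : V)) _ hX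
  have h6 := hF2 p u
  exact ((add_comm _ _).trans (congrArg₂ (· + ·) h5 h6)).trans (map_add (ρ p) _ _).symm

end Mu

/-! ### Pulling back linear vector fields. -/

section PullbackAction

variable {E : Type*} [NormedAddCommGroup E] [NormedSpace ℂ E] [CompleteSpace E]
  {B : Type*} [TopologicalSpace B] (I : ModelWithCorners ℂ E B)
  {X : Type*} [TopologicalSpace X] [ChartedSpace B X] [IsManifold I ω X]
  {V : Type*} [NormedAddCommGroup V] [NormedSpace ℂ V] [FiniteDimensional ℂ V]
  {L : Type*} [LieRing L] [LieAlgebra ℂ L]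

/-- The linear vector field given by an endomorphism. -/
def linearField (A : Module.End ℂ V) (v : V) : TangentSpace 𝓘(ℂ, V) v := A v

/-- The pullback under `f` of the linear vector fields given by `φ`. -/
noncomputable def pullbackAction (φ : L →ₗ[ℂ] Module.End ℂ V) (f : X → V) :
    L →ₗ[ℂ] ((p : X) → TangentSpace I p) where
  toFun a := VectorField.mpullback I 𝓘(ℂ, V) f (linearField (φ a))
  map_add' a b := by
    rw [← VectorField.mpullback_add, map_add]
    rfl
  map_smul' c a := by
    rw [RingHom.id_apply, ← VectorField.mpullback_const_smul, map_smul]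
    rfl

theorem contMDiff_linearField (A : Module.End ℂ V) :
    ContMDiff 𝓘(ℂ, V) 𝓘(ℂ, V).tangent ω
      (fun v => (⟨v, linearField A v⟩ : TangentBundle 𝓘(ℂ, V) V)) := by
  intro v
  rw [contMDiffAt_vectorSpace_iff_contDiffAt]
  exact (LinearMap.toContinuousLinearMap A).contDiff.contDiffAt

/-- The bracket of vector fields reverses the order of linear fields. This is the sign that the
swapped arguments in `IsInfinitesimalAction` compensate. -/
theorem mlieBracket_linearField (A A' : Module.End ℂ V) :
    VectorField.mlieBracket 𝓘(ℂ, V) (linearField A) (linearField A') = linearField ⁅A', A⁆ := by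
  ext v
  rw [← VectorField.mlieBracketWithin_univ, VectorField.mlieBracketWithin_eq_lieBracketWithin]
  have h : ∀ (C : Module.End ℂ V) (v : V),
      HasFDerivAt (fun w => C w) (LinearMap.toContinuousLinearMap C) v :=
    fun C v => (LinearMap.toContinuousLinearMap C).hasFDerivAt
  have h1 : VectorField.lieBracketWithin ℂ (fun w => A w) (fun w => A' w) Set.univ v =
      ⁅A', A⁆ v := by
    rw [VectorField.lieBracketWithin_univ, VectorField.lieBracket, (h A v).fderiv, (h A' v).fderiv]
    rfl
  exact h1

variable {I}

/-- This is the equivariance of `f`. Invertibility is needed because the pullback uses an inverse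
that is `0` by convention where the derivative is not invertible. -/
theorem mfderiv_pullbackAction (φ : L →ₗ[ℂ] Module.End ℂ V) {f : X → V} {p : X}
    (hp : (mfderiv I 𝓘(ℂ, V) f p).IsInvertible) (a : L) :
    mfderiv I 𝓘(ℂ, V) f p (pullbackAction I φ f a p) = φ a (f p) :=
  hp.self_apply_inverse _

/-- Pullback along a map with invertible derivative preserves holomorphy and commutes with the
bracket, so both properties are inherited from the linear fields on `V`. -/
theorem isInfinitesimalAction_pullbackAction (φ : L →ₗ[ℂ] Module.End ℂ V)
    (hφ : ∀ a b, φ ⁅a, b⁆ = ⁅φ a, φ b⁆) {f : X → V} (hf : ContMDiff I 𝓘(ℂ, V) ω f) {U : Set X}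
    (hU : ∀ p ∈ U, (mfderiv I 𝓘(ℂ, V) f p).IsInvertible) [IsManifold I 1 X] :
    IsInfinitesimalAction I (pullbackAction I φ f) U where
  holomorphic a p hp :=
    (ContMDiffAt.mpullback_vectorField_preimage (contMDiff_linearField (φ a) (f p)) (hf p)
      (hU p hp) (by simp)).contMDiffWithinAt
  bracket a b p hp := by
    have h := VectorField.mpullback_mlieBracket (n := ω)
      (((contMDiff_linearField (φ b)) (f p)).mdifferentiableAt (by simp))
      (((contMDiff_linearField (φ a)) (f p)).mdifferentiableAt (by simp)) (hf p) (by simp)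
    rw [mlieBracket_linearField, ← hφ] at h
    exact h

/-- The derivative of a biholomorphic map is invertible. -/
theorem isInvertible_mfderiv_of_openPartialHomeomorph {f : X → V} (hf : ContMDiff I 𝓘(ℂ, V) ω f)
    {Φ : OpenPartialHomeomorph X V} (hΦ : ∀ p ∈ Φ.source, Φ p = f p)
    (hs : ContMDiffOn 𝓘(ℂ, V) I ω Φ.symm Φ.target) {p : X} (hp : p ∈ Φ.source) :
    (mfderiv I 𝓘(ℂ, V) f p).IsInvertible := by
  have h1 : Φ.MDifferentiable I 𝓘(ℂ, V) :=
    ⟨fun q hq => ((hf.mdifferentiableAt (by simp)).congr_of_eventuallyEq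
      (Filter.eventuallyEq_of_mem (Φ.open_source.mem_nhds hq) hΦ)).mdifferentiableWithinAt,
      hs.mdifferentiableOn (by simp)⟩
  refine ⟨h1.mfderiv hp, ?_⟩
  have h2 : mfderiv I 𝓘(ℂ, V) Φ p = mfderiv I 𝓘(ℂ, V) f p :=
    Filter.EventuallyEq.mfderiv_eq (Filter.eventuallyEq_of_mem (Φ.open_source.mem_nhds hp) hΦ)
  rw [← h2]
  rfl

end PullbackAction

/-! ### Linear algebra of the slice: `1 + θ(n)` and the stabilizer of `x + n`. -/

section SliceAlgebra

variable {m : ℕ} {G : Subgroup (GL (Fin m) ℂ)}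
  {V : Type*} [NormedAddCommGroup V] [NormedSpace ℂ V] [FiniteDimensional ℂ V]
  (hG : IsZariskiClosed (G : Set (GL (Fin m) ℂ)))
  {ρ : Representation ℂ G V} (hρ : IsRational ρ) {x : V}
  {S : Submodule ℂ (lieAlg G)} {N : Submodule ℂ V}

/-- The kernel of `X ↦ X · x` is the Lie algebra of the stabilizer. A complement `S` of it therefore
maps isomorphically onto the orbit tangent space, to which `N` is complementary. -/
theorem sliceMap_bijective (hS : IsCompl S (lieIn G (stabilizer ρ x)))
    (hN : IsCompl (orbitTangent hG hρ x) N) : Function.Bijective (sliceMap hG hρ x S N) := by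
  constructor
  · rw [← LinearMap.ker_eq_bot, LinearMap.ker_eq_bot']
    rintro ⟨s, n⟩ h
    have h1 : dRep hG hρ s x + (n : V) = 0 := h
    have h2 : (n : V) = 0 := by
      refine Submodule.disjoint_def.1 hN.disjoint _ ⟨-s, ?_⟩ n.2
      rw [LinearMap.flip_apply, map_neg, LinearMap.neg_apply]
      exact neg_eq_of_add_eq_zero_right h1
    rw [h2, add_zero] at h1
    have h3 : (s : lieAlg G) = 0 :=
      Submodule.disjoint_def.1 hS.disjoint _ s.2 ((mem_lieIn_stabilizer hG hρ).2 h1)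
    ext1
    · exact Subtype.ext h3
    · exact Subtype.ext h2
  · intro v
    obtain ⟨_, ⟨X, rfl⟩, n, hn, rfl⟩ := Submodule.mem_sup.1
      (hN.sup_eq_top ▸ Submodule.mem_top : v ∈ orbitTangent hG hρ x ⊔ N)
    obtain ⟨s, hs, h, hh, rfl⟩ := Submodule.mem_sup.1
      (hS.sup_eq_top ▸ Submodule.mem_top : X ∈ S ⊔ lieIn G (stabilizer ρ x))
    refine ⟨(⟨s, hs⟩, ⟨n, hn⟩), ?_⟩
    change dRep hG hρ s x + n = dRep hG hρ (s + h) x + n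
    rw [map_add, LinearMap.add_apply, (mem_lieIn_stabilizer hG hρ).1 hh, add_zero]

variable {hG hρ}

theorem lam_spec (h : Function.Bijective (sliceMap hG hρ x S N)) (v : V) :
    dRep hG hρ (lamS hG hρ x S N v : lieAlg G) x + (lamN hG hρ x S N v : V) = v := by
  have h1 : sliceMap hG hρ x S N (sliceInv hG hρ x S N v) = v := by
    rw [sliceInv, dif_pos h]
    exact (LinearEquiv.ofBijective (sliceMap hG hρ x S N) h).apply_symm_apply v
  exact h1

/-- `1 + θ(n)` first splits `v` at `x` and then recombines the two components with `x + n` in place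
of `x`. Its invertibility is thus equivalent to `S · (x + n)` and `N` decomposing `V`. -/
theorem one_add_theta_apply (h : Function.Bijective (sliceMap hG hρ x S N)) (n : N) (v : V) :
    (1 + theta hG hρ x S N n) v =
      dRep hG hρ (lamS hG hρ x S N v : lieAlg G) (x + (n : V)) + (lamN hG hρ x S N v : V) := by
  rw [map_add]
  nth_rewrite 1 [LinearMap.add_apply, Module.End.one_apply, ← lam_spec h v]
  change _ + dRep hG hρ (lamS hG hρ x S N v : lieAlg G) (n : V) = _
  abel

/-- The vectors `s · (x + n) + u` with `s ∈ S` and `u ∈ N` determine `s` and `u`. -/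
def IsTransversalAt (hG : IsZariskiClosed (G : Set (GL (Fin m) ℂ))) {ρ : Representation ℂ G V}
    (hρ : IsRational ρ) (x : V) (S : Submodule ℂ (lieAlg G)) (N : Submodule ℂ V) (n : N) : Prop :=
  ∀ s ∈ S, ∀ u ∈ N, dRep hG hρ s (x + (n : V)) + u = 0 → s = 0 ∧ u = 0

namespace IsTransversalAt

variable {n : N}

theorem isUnit (hn : IsTransversalAt hG hρ x S N n)
    (h : Function.Bijective (sliceMap hG hρ x S N)) : IsUnit (1 + theta hG hρ x S N n) := by
  rw [LinearMap.isUnit_iff_ker_eq_bot, LinearMap.ker_eq_bot']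
  intro v hv
  rw [one_add_theta_apply h] at hv
  obtain ⟨h1, h2⟩ := hn _ (lamS hG hρ x S N v).2 _ (lamN hG hρ x S N v).2 hv
  rw [← lam_spec h v, h1, h2]
  simp

theorem thetaInv_spec (hn : IsTransversalAt hG hρ x S N n)
    (h : Function.Bijective (sliceMap hG hρ x S N)) (v : V) :
    dRep hG hρ (lamS hG hρ x S N (thetaInv hG hρ x S N n v) : lieAlg G) (x + (n : V)) +
      (lamN hG hρ x S N (thetaInv hG hρ x S N n v) : V) = v := by
  rw [← one_add_theta_apply h, ← Module.End.mul_apply, thetaInv,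
    Ring.mul_inverse_cancel _ (hn.isUnit h), Module.End.one_apply]

/-- The source of all explicit formulas: `(1 + θ(n))⁻¹` provides one solution of `s · (x + n) + u =
v`, and transversality leaves no other. -/
theorem eq_of_add_eq (hn : IsTransversalAt hG hρ x S N n)
    (h : Function.Bijective (sliceMap hG hρ x S N)) {v : V} {s : lieAlg G} (hs : s ∈ S) {u : V}
    (hu : u ∈ N) (hv : dRep hG hρ s (x + (n : V)) + u = v) :
    s = (lamS hG hρ x S N (thetaInv hG hρ x S N n v) : lieAlg G) ∧
      u = (lamN hG hρ x S N (thetaInv hG hρ x S N n v) : V) := by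
  have h1 := hn.thetaInv_spec h v
  have h2 := hn _ (S.sub_mem hs (lamS hG hρ x S N (thetaInv hG hρ x S N n v)).2) _
    (N.sub_mem hu (lamN hG hρ x S N (thetaInv hG hρ x S N n v)).2) (by
      rw [map_sub, LinearMap.sub_apply, sub_add_sub_comm, hv, h1, sub_self])
  exact ⟨sub_eq_zero.1 h2.1, sub_eq_zero.1 h2.2⟩

/-- The part of `G` that stabilizes `x + n` is described by a subspace of the Lie algebra of the
stabilizer of `x`. -/
theorem exists_submodule {R Q : Submodule ℂ (lieAlg G)} (hn : IsTransversalAt hG hρ x S N n)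
    (h : Function.Bijective (sliceMap hG hρ x S N))
    (hS : IsCompl S (lieIn G (stabilizer ρ x)))
    (hR : R ≤ lieIn G (stabilizer ρ x)) (hQ : Q ≤ lieIn G (stabilizer ρ x))
    (hRQ : ∀ X ∈ lieIn G (stabilizer ρ x), ∃ r ∈ R, ∃ q ∈ Q, X = r + q)
    (hRN : ∀ r ∈ R, dRep hG hρ r (n : V) ∈ N) :
    ∃ Hn : Submodule ℂ (lieAlg G), Hn ≤ lieIn G (stabilizer ρ x) ∧
      Module.finrank ℂ Hn = Module.finrank ℂ (lieIn G (stabilizer ρ (x + (n : V)))) ∧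
      (∀ r ∈ R, ∀ q ∈ Q, q + r ∈ Hn ↔ dRep hG hρ r (n : V) +
        (lamN hG hρ x S N (thetaInv hG hρ x S N n (dRep hG hρ q (n : V))) : V) = 0) ∧
      (∀ g ∈ lieIn G (stabilizer ρ (x + (n : V))),
        ∃! h : lieAlg G, h ∈ Hn ∧ ∃ r ∈ R, ∃ q ∈ Q, h = q + r ∧
          dRep hG hρ r (n : V) +
            (lamN hG hρ x S N (thetaInv hG hρ x S N n (dRep hG hρ q (n : V))) : V) = 0 ∧
          g = h + -(lamS hG hρ x S N
            (thetaInv hG hρ x S N n (dRep hG hρ q (n : V))) : lieAlg G)) ∧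
      (∀ h ∈ Hn, ∃! s : lieAlg G, s ∈ S ∧ h + s ∈ lieIn G (stabilizer ρ (x + (n : V)))) := by
  let D := dRep hG hρ
  let H := lieIn G (stabilizer ρ x)
  let K := lieIn G (stabilizer ρ (x + (n : V)))
  have hH : ∀ X, X ∈ H ↔ D X x = 0 := fun X => mem_lieIn_stabilizer hG hρ
  have hK : ∀ X, X ∈ K ↔ D X (x + (n : V)) = 0 := fun X => mem_lieIn_stabilizer hG hρ
  have hHn : ∀ X ∈ H, D X (x + (n : V)) = D X (n : V) := fun X hX => by
    rw [map_add, (hH X).1 hX, zero_add]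
  have hadd : ∀ X Y v, D (X + Y) v = D X v + D Y v := fun X Y v => by
    rw [map_add, LinearMap.add_apply]
  have hsub : ∀ X Y v, D (X - Y) v = D X v - D Y v := fun X Y v => by
    rw [map_sub, LinearMap.sub_apply]
  have hKS : K ⊓ S = ⊥ := by
    rw [eq_bot_iff]
    rintro s ⟨hs1, hs2⟩
    exact (hn s hs2 0 N.zero_mem (by rw [add_zero]; exact (hK s).1 hs1)).1
  -- `H ⊓ (K ⊔ S)` is the projection of `K` to `H` along `S`. Its members are the `h = q + r` for
  -- which some `s ∈ S` satisfies `s · (x + n) = h · (x + n) = q · n + r · n`. Since `r · n ∈ N`,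
  -- this is a decomposition of `q · n` along `S · (x + n)` and `N`.
  have hmem : ∀ r ∈ R, ∀ q ∈ Q, q + r ∈ H ⊓ (K ⊔ S) ↔ D r (n : V) +
      (lamN hG hρ x S N (thetaInv hG hρ x S N n (D q (n : V))) : V) = 0 := by
    intro r hr q hq
    constructor
    · rintro ⟨-, h1⟩
      obtain ⟨g, hg, s, hs, hgs⟩ := Submodule.mem_sup.1 h1
      have h2 : D s (x + (n : V)) + -(D r (n : V)) = D q (n : V) := by
        have h3 : D (g + s) (x + (n : V)) = D (q + r) (x + (n : V)) := by rw [hgs]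
        rw [hadd, hadd, (hK g).1 hg, hHn q (hQ hq), hHn r (hR hr), zero_add] at h3
        rw [h3]
        abel
      have h4 := (hn.eq_of_add_eq h hs (N.neg_mem (hRN r hr)) h2).2
      rw [← h4]
      exact add_neg_cancel _
    · intro h1
      have h2 := hn.thetaInv_spec h (D q (n : V))
      refine ⟨H.add_mem (hQ hq) (hR hr), Submodule.mem_sup.2
        ⟨q + r - lamS hG hρ x S N (thetaInv hG hρ x S N n (D q (n : V))), ?_,
          lamS hG hρ x S N (thetaInv hG hρ x S N n (D q (n : V))), Submodule.coe_mem _,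
          sub_add_cancel _ _⟩⟩
      rw [hK, hsub, hadd, hHn q (hQ hq), hHn r (hR hr), eq_sub_of_add_eq h2, sub_sub_eq_add_sub,
        add_assoc, add_sub_cancel_left, h1]
  refine ⟨H ⊓ (K ⊔ S), inf_le_left, ?_, hmem, ?_, ?_⟩
  -- By the modular law and `H ⊔ S = ⊤`, the spaces `H ⊓ (K ⊔ S)` and `K` have the same sum with
  -- `S`. Both meet `S` in `0`, so their dimensions agree.
  · have h1 : (H ⊓ (K ⊔ S)) ⊔ S = K ⊔ S := by
      rw [sup_comm, ← sup_inf_assoc_of_le _ (le_sup_right : S ≤ K ⊔ S), hS.sup_eq_top, top_inf_eq]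
    have h2 : (H ⊓ (K ⊔ S)) ⊓ S = ⊥ := by
      rw [eq_bot_iff, ← hS.inf_eq_bot]
      exact fun s hs => ⟨hs.2, hs.1.1⟩
    have h3 := Submodule.finrank_sup_add_finrank_inf_eq (H ⊓ (K ⊔ S)) S
    have h4 := Submodule.finrank_sup_add_finrank_inf_eq K S
    rw [h1, h2] at h3
    rw [hKS] at h4
    exact Nat.add_right_cancel (h3.symm.trans h4)
  · intro g hg
    obtain ⟨s, hs, k, hk, rfl⟩ := Submodule.mem_sup.1
      (hS.sup_eq_top ▸ Submodule.mem_top : g ∈ S ⊔ lieIn G (stabilizer ρ x))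
    obtain ⟨r, hr, q, hq, rfl⟩ := hRQ k hk
    have h1 : D (-s) (x + (n : V)) + -(D r (n : V)) = D q (n : V) := by
      have h3 := (hK _).1 hg
      rw [hadd, hadd, hHn q (hQ hq), hHn r (hR hr)] at h3
      rw [map_neg, LinearMap.neg_apply, ← neg_add, neg_eq_iff_add_eq_zero, ← h3]
      abel
    obtain ⟨h4, h5⟩ := hn.eq_of_add_eq h (S.neg_mem hs) (N.neg_mem (hRN r hr)) h1
    have h6 : D r (n : V) +
        (lamN hG hρ x S N (thetaInv hG hρ x S N n (D q (n : V))) : V) = 0 := by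
      rw [← h5]
      exact add_neg_cancel _
    refine ⟨q + r, ⟨(hmem r hr q hq).2 h6, r, hr, q, hq, rfl, h6, ?_⟩, ?_⟩
    · rw [← h4]
      abel
    · rintro k' ⟨hk', r', hr', q', hq', -, -, hk''⟩
      -- Both `k'` and `r + q` differ from the same `g` by elements of `S`, so their difference lies
      -- in `S ⊓ H = 0`.
      have h7 : k' - (r + q) = s - -(lamS hG hρ x S N
            (thetaInv hG hρ x S N n (D q' (n : V))) : lieAlg G) := by
        rw [sub_eq_sub_iff_add_eq_add]
        exact hk''.symm
      have h8 := Submodule.disjoint_def.1 hS.disjoint (k' - (r + q))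
        (h7 ▸ S.sub_mem hs (S.neg_mem (Submodule.coe_mem _))) (H.sub_mem hk'.1 hk)
      rw [sub_eq_zero.1 h8, add_comm]
  · rintro k ⟨-, hk⟩
    obtain ⟨g, hg, s, hs, rfl⟩ := Submodule.mem_sup.1 hk
    refine ⟨-s, ⟨S.neg_mem hs, by rwa [add_neg_cancel_right]⟩, ?_⟩
    rintro t ⟨ht, hgt⟩
    have h1 : s + t ∈ K ⊓ S := by
      refine ⟨?_, S.add_mem hs ht⟩
      have h2 := K.sub_mem hgt hg
      rwa [add_assoc, add_sub_cancel_left] at h2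
    rw [hKS, Submodule.mem_bot] at h1
    exact eq_neg_of_add_eq_zero_right h1

end IsTransversalAt

end SliceAlgebra

/-! ### Existence of a submanifold with tangent space `S`. -/

section Existence

variable {m : ℕ}

/-- The matrix exponential, as a function with values in families of entries, along a linear map. -/
theorem contDiff_exp_comp {E : Type*} [NormedAddCommGroup E] [NormedSpace ℂ E]
    [FiniteDimensional ℂ E] (j : E →ₗ[ℂ] Matrix (Fin m) (Fin m) ℂ) :
    ContDiff ℂ ω (fun z : E => Matrix.of.symm (NormedSpace.exp (j z))) ∧
      HasFDerivAt (fun z : E => Matrix.of.symm (NormedSpace.exp (j z)))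
        (LinearMap.toContinuousLinearMap
          ((Matrix.ofLinearEquiv ℂ).symm.toLinearMap ∘ₗ j : E →ₗ[ℂ] Fin m → Fin m → ℂ)) 0 := by
  -- A submultiplicative norm is needed for the analyticity of `exp`. It stays inside the proof,
  -- since the statement takes values in families of entries.
  let _ : NormedRing (Matrix (Fin m) (Fin m) ℂ) := Matrix.linftyOpNormedRing
  let _ : NormedAlgebra ℂ (Matrix (Fin m) (Fin m) ℂ) := Matrix.linftyOpNormedAlgebra
  have : FiniteDimensional ℂ (Matrix (Fin m) (Fin m) ℂ) := inferInstance
  have : CompleteSpace (Matrix (Fin m) (Fin m) ℂ) := FiniteDimensional.complete ℂ _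
  let T : Matrix (Fin m) (Fin m) ℂ →L[ℂ] (Fin m → Fin m → ℂ) :=
    LinearMap.toContinuousLinearMap (Matrix.ofLinearEquiv ℂ).symm.toLinearMap
  let J : E →L[ℂ] Matrix (Fin m) (Fin m) ℂ := LinearMap.toContinuousLinearMap j
  constructor
  · have h : ContDiff ℂ ω (NormedSpace.exp : Matrix (Fin m) (Fin m) ℂ → _) :=
      contDiff_iff_contDiffAt.2 fun A => (NormedSpace.exp_analytic A).contDiffAt
    exact T.contDiff.comp (h.comp J.contDiff)
  · have h : HasFDerivAt (NormedSpace.exp : Matrix (Fin m) (Fin m) ℂ → _)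
        (1 : Matrix (Fin m) (Fin m) ℂ →L[ℂ] Matrix (Fin m) (Fin m) ℂ) (J 0) := by
      rw [map_zero]
      exact hasFDerivAt_exp_zero
    exact T.hasFDerivAt.comp 0 (h.comp 0 J.hasFDerivAt)

/-- A holomorphic map with injective derivative at the origin is an embedding and an immersion near
the origin. -/
theorem exists_leftInverse_of_hasFDerivAt {E W : Type*} [NormedAddCommGroup E] [NormedSpace ℂ E]
    [FiniteDimensional ℂ E] [NormedAddCommGroup W] [NormedSpace ℂ W] [FiniteDimensional ℂ W]
    {f : E → W} (hf : ContDiff ℂ ω f) {A : E →L[ℂ] W} (hA : HasFDerivAt f A 0)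
    (hinj : Function.Injective A) :
    ∃ (U : TopologicalSpace.Opens E) (r : W → E), 0 ∈ U ∧ (∀ z ∈ U, r (f z) = z) ∧
      ContinuousOn r (f '' U) ∧ ∀ z ∈ U, Function.Injective (fderiv ℂ f z) := by
  -- For a linear left inverse `P` of the derivative, `P ∘ f` has derivative `1` at `0` and is a
  -- local biholomorphism. Its inverse composed with `P` is the retraction `r`, and injectivity of
  -- the derivative of `P ∘ f` forces that of `f`.
  obtain ⟨P, hP⟩ := LinearMap.exists_leftInverse_of_injective A.toLinearMap
    (LinearMap.ker_eq_bot.2 hinj)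
  let P' : W →L[ℂ] E := LinearMap.toContinuousLinearMap P
  have hPf : ContDiff ℂ ω (P' ∘ f) := P'.contDiff.comp hf
  have hPf0 : HasFDerivAt (P' ∘ f) (ContinuousLinearEquiv.refl ℂ E : E →L[ℂ] E) 0 := by
    refine (P'.hasFDerivAt.comp 0 hA).congr_fderiv ?_
    ext1 z
    exact LinearMap.congr_fun hP z
  have : CompleteSpace E := FiniteDimensional.complete ℂ E
  obtain ⟨Φ, h0, hΦ, hΦs⟩ := exists_openPartialHomeomorph_of_mfderiv (I := 𝓘(ℂ, E))
    hPf.contMDiff hPf0.hasMFDerivAt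
  refine ⟨⟨Φ.source, Φ.open_source⟩, Φ.symm ∘ P', h0, fun z hz => ?_, ?_, fun z hz => ?_⟩
  · exact (congrArg Φ.symm (hΦ z hz)).symm.trans (Φ.left_inv hz)
  · refine Φ.continuousOn_symm.comp P'.continuous.continuousOn ?_
    rintro _ ⟨z, hz, rfl⟩
    have h1 : P' (f z) = Φ z := (hΦ z hz).symm
    rw [h1]
    exact Φ.map_source hz
  · have h1 := isInvertible_mfderiv_of_openPartialHomeomorph hPf.contMDiff hΦ hΦs hz
    have h2 : HasMFDerivAt 𝓘(ℂ, E) 𝓘(ℂ, E) (P' ∘ f) z (P'.comp (fderiv ℂ f z)) :=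
      (P'.hasFDerivAt.comp z (hf.differentiable (by simp) z).hasFDerivAt).hasMFDerivAt
    rw [h2.mfderiv] at h1
    exact Function.Injective.of_comp h1.injective

variable {G : Subgroup (GL (Fin m) ℂ)}

/-- There is a submanifold of `G` through the identity with a given tangent space. -/
theorem exists_isTransversal (hG : IsZariskiClosed (G : Set (GL (Fin m) ℂ)))
    (S : Submodule ℂ (lieAlg G)) :
    ∃ (M : Set G) (_ : ChartedSpace (EuclideanSpace ℂ (Fin (Module.finrank ℂ S))) M)
      (_ : IsManifold 𝓘(ℂ, EuclideanSpace ℂ (Fin (Module.finrank ℂ S))) ω M),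
      IsTransversal (Module.finrank ℂ S) S M := by
  let E := EuclideanSpace ℂ (Fin (Module.finrank ℂ S))
  let L : E ≃ₗ[ℂ] S := LinearEquiv.ofFinrankEq _ _ finrank_euclideanSpace_fin
  let j : E →ₗ[ℂ] Matrix (Fin m) (Fin m) ℂ :=
    (lieAlg G).toSubmodule.subtype ∘ₗ S.subtype ∘ₗ L.toLinearMap
  have hj : Function.Injective j :=
    Subtype.val_injective.comp (Subtype.val_injective.comp L.injective)
  let ex : E → Fin m → Fin m → ℂ := fun z => Matrix.of.symm (NormedSpace.exp (j z))
  obtain ⟨hex, hex0⟩ := contDiff_exp_comp j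
  obtain ⟨U, r, h0, hr, hrc, hinj⟩ := exists_leftInverse_of_hasFDerivAt hex hex0
    ((Matrix.ofLinearEquiv ℂ).symm.injective.comp hj)
  let c : E → G := fun z => expG hG (L z)
  have hc : Continuous c := by
    have h1 : Continuous fun z : E => NormedSpace.exp (j z) := hex.continuous
    refine Continuous.subtype_mk (Units.continuous_iff.2 ⟨h1, ?_⟩) _
    have h2 : (fun z => ((expGL (j z))⁻¹ : GL (Fin m) ℂ).val) =
        fun z => NormedSpace.exp (j (-z)) := by
      ext1 z
      rw [map_neg, Matrix.exp_neg, Matrix.coe_units_inv]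
      rfl
    exact h2 ▸ h1.comp continuous_neg
  -- `M` is the exponential image of a small neighbourhood of `0` in `S`. The retraction `r` makes
  -- the parametrization a homeomorphism onto `M`, so one global chart suffices.
  let M : Set G := c '' U
  let T : U ≃ₜ M :=
    { toFun := fun z => ⟨c z, z, z.2, rfl⟩
      invFun := fun p => ⟨r (toMat M p), by
        obtain ⟨_, z, hz, rfl⟩ := p
        exact (hr z hz).symm ▸ hz⟩
      left_inv := fun z => Subtype.ext (hr z z.2)
      right_inv := by
        rintro ⟨_, z, hz, rfl⟩
        exact Subtype.ext (congrArg c (hr z hz))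
      continuous_toFun := (hc.comp continuous_subtype_val).subtype_mk _
      continuous_invFun := by
        refine Continuous.subtype_mk (hrc.comp_continuous ?_ ?_) _
        · exact continuous_coe_GL.comp (continuous_subtype_val.comp continuous_subtype_val)
        · rintro ⟨_, z, hz, rfl⟩
          exact ⟨z, hz, rfl⟩ }
  have hemb : Topology.IsOpenEmbedding (fun p : M => (T.symm p : E)) :=
    U.isOpenEmbedding'.comp T.symm.isOpenEmbedding
  have : Nonempty M := ⟨T ⟨0, h0⟩⟩
  let _ : ChartedSpace E M := hemb.singletonChartedSpace
  have hman : IsManifold 𝓘(ℂ, E) ω M := hemb.isManifold_singleton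
  have hext : ∀ p : M, (extChartAt 𝓘(ℂ, E) p : M → E) = fun q => (T.symm q : E) := fun p => by
    ext1 q
    rfl
  have hmat : ∀ p : M, toMat M = ex ∘ extChartAt 𝓘(ℂ, E) p := by
    intro p
    ext1 q
    obtain ⟨z, rfl⟩ := T.surjective q
    rw [hext, Function.comp_apply, T.symm_apply_apply]
    rfl
  have hchart : ∀ p : M, MDifferentiableAt 𝓘(ℂ, E) 𝓘(ℂ, E) (extChartAt 𝓘(ℂ, E) p) p :=
    fun p => mdifferentiableAt_extChartAt (mem_chart_source E p)
  have hmf : ∀ p : M, HasMFDerivAt 𝓘(ℂ, E) 𝓘(ℂ, Fin m → Fin m → ℂ) (toMat M) p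
      ((fderiv ℂ ex (T.symm p : E)).comp
        (mfderiv 𝓘(ℂ, E) 𝓘(ℂ, E) (extChartAt 𝓘(ℂ, E) p) p)) := by
    intro p
    rw [hmat p]
    exact HasMFDerivAt.comp p
      ((hex.differentiable (by simp) _).hasFDerivAt.hasMFDerivAt) (hchart p).hasMFDerivAt
  have hd : ∀ (p : M) (w : TangentSpace 𝓘(ℂ, E) p), dToMat (Module.finrank ℂ S) M p w =
      Matrix.of (fderiv ℂ ex (T.symm p : E)
        (mfderiv 𝓘(ℂ, E) 𝓘(ℂ, E) (extChartAt 𝓘(ℂ, E) p) p w)) :=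
    fun p w => congrArg (fun B : TangentSpace 𝓘(ℂ, E) p →L[ℂ] Fin m → Fin m → ℂ =>
      Matrix.of (B w)) (hmf p).mfderiv
  have hone : (1 : G) ∈ M := ⟨0, h0, by
    ext1; ext1
    simp [c, expG]⟩
  refine ⟨M, inferInstance, hman, ?_, ?_, hone, ?_⟩
  · intro p
    rw [hmat p]
    exact (hex.contMDiff _).comp p contMDiffAt_extChartAt
  · intro p
    have h1 := hinj _ (T.symm p).2
    have h2 := isInvertible_mfderiv_extChartAt (I := 𝓘(ℂ, E)) (mem_extChartAt_source p)
    intro w w' hw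
    rw [hd, hd] at hw
    exact h2.injective (h1 (Matrix.of.injective hw))
  · have h1 : T.symm ⟨1, hone⟩ = ⟨0, h0⟩ := by
      rw [T.symm_apply_eq]
      ext1; ext1; ext1
      simp [T, c, expG]
    have h2 := isInvertible_mfderiv_extChartAt (I := 𝓘(ℂ, E))
      (mem_extChartAt_source (⟨1, hone⟩ : M))
    have h3 : ∀ w, dToMat (Module.finrank ℂ S) M ⟨1, hone⟩ w =
        j (mfderiv 𝓘(ℂ, E) 𝓘(ℂ, E) (extChartAt 𝓘(ℂ, E) (⟨1, hone⟩ : M)) ⟨1, hone⟩ w) := by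
      intro w
      have h5 : fderiv ℂ ex (T.symm ⟨1, hone⟩ : E) = LinearMap.toContinuousLinearMap
          ((Matrix.ofLinearEquiv ℂ).symm.toLinearMap ∘ₗ j : E →ₗ[ℂ] Fin m → Fin m → ℂ) := by
        rw [congrArg Subtype.val h1]
        exact hex0.fderiv
      exact (hd _ w).trans (congrArg (fun B : E →L[ℂ] Fin m → Fin m → ℂ => Matrix.of (B _)) h5)
    ext X
    constructor
    · rintro ⟨w, rfl⟩
      rw [h3]
      exact ⟨_, (L _).2, rfl⟩
    · rintro ⟨s, hs, rfl⟩
      obtain ⟨w, hw⟩ := h2.surjective (L.symm ⟨s, hs⟩)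
      refine ⟨w, ?_⟩
      rw [h3, hw]
      simp [j]

end Existence

/-! ### The derivative of `mu` and transversality. -/

section LocalModelMap

variable {m : ℕ} {G : Subgroup (GL (Fin m) ℂ)}
  {V : Type*} [NormedAddCommGroup V] [NormedSpace ℂ V] [FiniteDimensional ℂ V]
  {hG : IsZariskiClosed (G : Set (GL (Fin m) ℂ))}
  {ρ : Representation ℂ G V} {hρ : IsRational ρ} {x : V}
  {S : Submodule ℂ (lieAlg G)} {N : Submodule ℂ V}
  {d : ℕ} {M : Set G} [ChartedSpace (EuclideanSpace ℂ (Fin d)) M]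

theorem IsTransversal.exists_dToMat_eq (hM : IsTransversal d S M)
    (w : TangentSpace 𝓘(ℂ, EuclideanSpace ℂ (Fin d)) (⟨1, hM.one_mem⟩ : M)) :
    ∃ s ∈ S, (s : Matrix (Fin m) (Fin m) ℂ) = dToMat d M ⟨1, hM.one_mem⟩ w :=
  hM.tangent.le ⟨w, rfl⟩

theorem IsTransversal.exists_eq_dToMat (hM : IsTransversal d S M) {s : lieAlg G} (hs : s ∈ S) :
    ∃ w, dToMat d M ⟨1, hM.one_mem⟩ w = (s : Matrix (Fin m) (Fin m) ℂ) :=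
  hM.tangent.ge ⟨s, hs, rfl⟩

theorem IsTransversal.mfderiv_mu_one (hM : IsTransversal d S M) (n : N)
    (w : TangentSpace 𝓘(ℂ, EuclideanSpace ℂ (Fin d)) (⟨1, hM.one_mem⟩ : M)) (u : N)
    {s : lieAlg G} (hs : (s : Matrix (Fin m) (Fin m) ℂ) = dToMat d M ⟨1, hM.one_mem⟩ w) :
    mfderiv (𝓘(ℂ, EuclideanSpace ℂ (Fin d)).prod 𝓘(ℂ, N)) 𝓘(ℂ, V) (mu ρ x M N)
      (⟨1, hM.one_mem⟩, n) (w, u) = dRep hG hρ s (x + (n : V)) + (u : V) := by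
  have h1 : Matrix.of (toMat M ⟨1, hM.one_mem⟩) = 1 := by
    ext i j
    simp [toMat]
  rw [mfderiv_mu hρ hG hM.holomorphic _ n w u s (by rw [h1, one_mul, hs]), map_one]
  rfl

theorem IsTransversal.eq_zero_of_dToMat (hM : IsTransversal d S M) {p : M}
    {w : TangentSpace 𝓘(ℂ, EuclideanSpace ℂ (Fin d)) p} (hw : dToMat d M p w = 0) : w = 0 := by
  refine hM.immersion p (hw.trans ?_)
  rw [dToMat, map_zero]
  rfl

/-- The derivative of `μ` at the point `(e, 0)` is invertible. -/
theorem IsTransversal.exists_hasMFDerivAt_mu (hM : IsTransversal d S M)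
    (hbij : Function.Bijective (sliceMap hG hρ x S N)) :
    ∃ A : (EuclideanSpace ℂ (Fin d) × N) ≃L[ℂ] V,
      HasMFDerivAt (𝓘(ℂ, EuclideanSpace ℂ (Fin d)).prod 𝓘(ℂ, N)) 𝓘(ℂ, V) (mu ρ x M N)
        (⟨1, hM.one_mem⟩, 0) (A : (EuclideanSpace ℂ (Fin d) × N) →L[ℂ] V) := by
  let B : (EuclideanSpace ℂ (Fin d) × N) →L[ℂ] V :=
    mfderiv (𝓘(ℂ, EuclideanSpace ℂ (Fin d)).prod 𝓘(ℂ, N)) 𝓘(ℂ, V) (mu ρ x M N)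
      (⟨1, hM.one_mem⟩, 0)
  have hB : HasMFDerivAt (𝓘(ℂ, EuclideanSpace ℂ (Fin d)).prod 𝓘(ℂ, N)) 𝓘(ℂ, V) (mu ρ x M N)
      (⟨1, hM.one_mem⟩, 0) B :=
    ((contMDiff_mu hρ hG hM.holomorphic).mdifferentiableAt (by simp)).hasMFDerivAt
  -- After identifying the tangent space of `M` at `e` with `S`, the derivative at `n = 0` is the
  -- slice isomorphism.
  have hval : ∀ w u, ∀ s : S, ((s : lieAlg G) : Matrix (Fin m) (Fin m) ℂ) =
      dToMat d M ⟨1, hM.one_mem⟩ w → B (w, u) = sliceMap hG hρ x S N (s, u) := by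
    intro w u s hs
    refine (hM.mfderiv_mu_one (hG := hG) (hρ := hρ) 0 w u hs).trans ?_
    rw [Submodule.coe_zero, add_zero]
    rfl
  have hinj : Function.Injective B := by
    rw [injective_iff_map_eq_zero]
    rintro ⟨w, u⟩ h
    obtain ⟨s, hs, hsw⟩ := hM.exists_dToMat_eq w
    rw [hval w u ⟨s, hs⟩ hsw] at h
    have h1 := (map_eq_zero_iff _ hbij.1).1 h
    have h2 : s = 0 := congrArg Subtype.val (congrArg Prod.fst h1)
    have h3 : w = 0 := hM.eq_zero_of_dToMat (by rw [← hsw, h2]; rfl)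
    exact Prod.ext h3 (congrArg Prod.snd h1 :)
  have hsurj : Function.Surjective B := by
    intro v
    obtain ⟨⟨s, u⟩, rfl⟩ := hbij.2 v
    obtain ⟨w, hw⟩ := hM.exists_eq_dToMat s.2
    exact ⟨(w, u), hval w u s hw.symm⟩
  let A := (LinearEquiv.ofBijective (B : (EuclideanSpace ℂ (Fin d) × N) →ₗ[ℂ] V)
    ⟨hinj, hsurj⟩).toContinuousLinearEquiv
  refine ⟨A, ?_⟩
  have h : (A : (EuclideanSpace ℂ (Fin d) × N) →L[ℂ] V) = B := ContinuousLinearMap.ext fun _ => rfl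
  rw [h]
  exact hB

/-- Where the derivative of `μ` at `(e, n)` is injective, `S` and `N` are transversal. -/
theorem IsTransversal.isTransversalAt (hM : IsTransversal d S M) {n : N}
    (hinj : Function.Injective (mfderiv (𝓘(ℂ, EuclideanSpace ℂ (Fin d)).prod 𝓘(ℂ, N)) 𝓘(ℂ, V)
      (mu ρ x M N) (⟨1, hM.one_mem⟩, n))) : IsTransversalAt hG hρ x S N n := by
  intro s hs u hu h
  obtain ⟨w, hw⟩ := hM.exists_eq_dToMat hs
  have h1 := hM.mfderiv_mu_one (hG := hG) (hρ := hρ) (x := x) n w ⟨u, hu⟩ hw.symm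
  have h2 := hinj ((h1.trans h).trans (map_zero _).symm)
  have h3 : w = 0 := congrArg Prod.fst h2
  have h4 : (⟨u, hu⟩ : N) = 0 := congrArg Prod.snd h2
  refine ⟨?_, congrArg Subtype.val h4⟩
  ext1
  rw [← hw, h3, dToMat, map_zero]
  rfl

/-- The tangent spaces of `M × N` meet those of the orbits of the stabilizer of `x` in `0` wherever
the derivative of `μ` is injective. -/
theorem IsTransversal.eq_zero_of_orbit (hM : IsTransversal d S M) {p : M} {n : N}
    (hinj : Function.Injective (mfderiv (𝓘(ℂ, EuclideanSpace ℂ (Fin d)).prod 𝓘(ℂ, N)) 𝓘(ℂ, V)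
      (mu ρ x M N) (p, n))) {w : TangentSpace 𝓘(ℂ, EuclideanSpace ℂ (Fin d)) p} {u : N}
    {h : lieAlg G} (hh : h ∈ lieIn G (stabilizer ρ x))
    (hw : dToMat d M p w = -(Matrix.of (toMat M p) * h))
    (hu : (u : V) = dRep hG hρ h (n : V)) : w = 0 ∧ u = 0 := by
  -- The vector `(-p h, h · n)` is tangent to the `H`-orbit, along which `g · (x + v)` is constant.
  -- Indeed its image is `p · (-h · (x + n) + h · n) = 0`, because `h · x = 0`.
  have h1 := mfderiv_mu (x := x) hρ hG hM.holomorphic p n w u (-h) (by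
    rw [hw, ← mul_neg]
    rfl)
  have h2 : dRep hG hρ (-h) (x + (n : V)) + u = 0 := by
    rw [map_neg, LinearMap.neg_apply, map_add, (mem_lieIn_stabilizer hG hρ).1 hh, hu, zero_add,
      neg_add_cancel]
  rw [h2, map_zero] at h1
  have h3 := hinj (h1.trans (map_zero _).symm)
  exact ⟨congrArg Prod.fst h3, congrArg Prod.snd h3⟩

end LocalModelMap

/-! ### The embedding in `G ×_H V`. -/

section AssociatedBundle

variable {m : ℕ} {G : Subgroup (GL (Fin m) ℂ)}
  {V : Type*} [NormedAddCommGroup V] [NormedSpace ℂ V]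
  {ρ : Representation ℂ G V} {x : V}

/-- The action of `G` on the associated bundle, `[g, v] ↦ g (x + v)`. -/
noncomputable def bundleMap (ρ : Representation ℂ G V) (x : V) : AssocBundle ρ x → V :=
  Quotient.lift (fun a : G × V => ρ a.1 (x + a.2)) (by
    rintro a b ⟨h, hx, rfl⟩
    have h1 : ρ h x + ρ h a.2 = ρ h (x + a.2) := (map_add _ _ _).symm
    change ρ a.1 (x + a.2) = ρ (a.1 * h⁻¹) (x + ρ h a.2)
    nth_rewrite 2 [← hx]
    rw [h1, ← Module.End.mul_apply, ← map_mul, inv_mul_cancel_right])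

theorem continuous_bundleMap [FiniteDimensional ℂ V]
    (hG : IsZariskiClosed (G : Set (GL (Fin m) ℂ)))
    (hρ : IsRational ρ) : Continuous (bundleMap ρ x) := by
  obtain ⟨F, hF1, hF2, -⟩ := exists_entries_extension hG hρ
  refine Continuous.quotient_lift ?_ _
  have h1 : Continuous fun g : G =>
      F (fun i j => ((g : GL (Fin m) ℂ) : Matrix (Fin m) (Fin m) ℂ) i j) :=
    continuous_iff_continuousAt.2 fun g => ContinuousAt.comp (hF1 g).continuousAt
      (continuous_coe_GL.comp continuous_subtype_val).continuousAt
  have h2 : (fun a : G × V => ρ a.1 (x + a.2)) = fun a : G × V =>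
      F (fun i j => ((a.1 : GL (Fin m) ℂ) : Matrix (Fin m) (Fin m) ℂ) i j) (x + a.2) := by
    ext1 a
    exact (hF2 _ _).symm
  rw [h2]
  exact (h1.comp continuous_fst).clm_apply (continuous_const.add continuous_snd)

/-- A set on which `μ` is a homeomorphism is embedded in the associated bundle. -/
theorem isEmbedding_mk [FiniteDimensional ℂ V] {N : Submodule ℂ V} {M : Set G}
    (hG : IsZariskiClosed (G : Set (GL (Fin m) ℂ))) (hρ : IsRational ρ)
    {Φ : OpenPartialHomeomorph (M × N) V} (hΦ : ∀ p ∈ Φ.source, Φ p = mu ρ x M N p) :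
    Topology.IsEmbedding (fun p : Φ.source =>
      (Quotient.mk (assocSetoid ρ x) ((p.1.1 : G), (p.1.2 : V)) : AssocBundle ρ x)) := by
  -- The composite with the continuous map `bundleMap` is `mu`, an open embedding on the source of
  -- `Φ`. Hence the first map is already an embedding, whatever the quotient topology looks like.
  refine Topology.IsEmbedding.of_comp ?_ (continuous_bundleMap hG hρ) ?_
  · refine continuous_quotient_mk'.comp ?_
    exact (continuous_subtype_val.comp (continuous_fst.comp continuous_subtype_val)).prodMk
      (continuous_subtype_val.comp (continuous_snd.comp continuous_subtype_val))
  · convert Φ.isOpenEmbedding_restrict.isEmbedding using 1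
    ext1 p
    exact (hΦ p p.2).symm

end AssociatedBundle

/-! ### The decomposition of the Lie algebra and the formula at `(e, n)`. -/

section Final

variable {m : ℕ} {G : Subgroup (GL (Fin m) ℂ)}
  {V : Type*} [NormedAddCommGroup V] [NormedSpace ℂ V] [FiniteDimensional ℂ V]
  {hG : IsZariskiClosed (G : Set (GL (Fin m) ℂ))}
  {ρ : Representation ℂ G V} {hρ : IsRational ρ} {x : V}
  {S : Submodule ℂ (lieAlg G)}

/-- The Lie algebra of `G` is the direct sum of `S` and of the Lie algebras of `R` and `Q`. -/
theorem existsUnique_decomposition (hG : IsZariskiClosed (G : Set (GL (Fin m) ℂ)))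
    (hρ : IsRational ρ) {R Q : Subgroup (GL (Fin m) ℂ)}
    (hLevi : IsLeviDecomposition (stabilizer ρ x) R Q)
    (hS : IsCompl S (lieIn G (stabilizer ρ x))) (g : lieAlg G) :
    ∃! t : S × lieIn G R × lieIn G Q,
      g = (t.1 : lieAlg G) + (t.2.1 : lieAlg G) + (t.2.2 : lieAlg G) := by
  have hR : lieIn G R ≤ lieIn G (stabilizer ρ x) := lieIn_mono G hLevi.le
  have hQ : lieIn G Q ≤ lieIn G (stabilizer ρ x) := lieIn_mono G hLevi.radical.le
  obtain ⟨s, hs, k, hk, rfl⟩ := Submodule.mem_sup.1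
    (hS.sup_eq_top ▸ Submodule.mem_top : g ∈ S ⊔ lieIn G (stabilizer ρ x))
  obtain ⟨r, hr, q, hq, rfl⟩ := hLevi.exists_add hG hρ hk
  refine ⟨(⟨s, hs⟩, ⟨r, hr⟩, ⟨q, hq⟩), (add_assoc _ _ _).symm, ?_⟩
  rintro ⟨⟨s', hs'⟩, ⟨r', hr'⟩, ⟨q', hq'⟩⟩ h
  have h : s + (r + q) = s' + r' + q' := h
  -- The two sides lie in `S` and in the Lie algebra of the stabilizer, so both vanish. What remains
  -- compares an element of the Lie algebra of `R` with one of `Q`, and these algebras meet in `0`.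
  have h1 : s' - s = (r - r') + (q - q') := by
    rw [sub_eq_iff_eq_add, ← sub_eq_zero]
    rw [← sub_eq_zero] at h
    rw [← neg_eq_zero, ← h]
    abel
  have h2 := Submodule.disjoint_def.1 hS.disjoint (s' - s) (S.sub_mem hs' hs) (h1 ▸
    Submodule.add_mem _ (Submodule.sub_mem _ (hR hr) (hR hr'))
      (Submodule.sub_mem _ (hQ hq) (hQ hq')))
  rw [h2, eq_comm] at h1
  have h3 : q - q' = r' - r := by
    rw [eq_neg_of_add_eq_zero_right h1, neg_sub]
  have h4 : q - q' = 0 := Subtype.ext (lieAlg_inf_eq_zero hLevi.reductive.closed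
    hLevi.radical.closed hLevi.disjoint
    (mem_lieIn.1 (h3 ▸ Submodule.sub_mem _ hr' hr : q - q' ∈ lieIn G R))
    (mem_lieIn.1 (Submodule.sub_mem _ hq hq')))
  rw [h4, eq_comm] at h3
  simp only [Prod.mk.injEq, Subtype.mk.injEq]
  exact ⟨sub_eq_zero.1 h2, sub_eq_zero.1 h3, (sub_eq_zero.1 h4).symm⟩

variable {N : Submodule ℂ V}
  {d : ℕ} {M : Set G} [ChartedSpace (EuclideanSpace ℂ (Fin d)) M]

/-- The explicit formula for the action of the Lie algebra at the points `(e, n)`. -/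
theorem IsTransversal.pullbackAction_one [IsManifold 𝓘(ℂ, EuclideanSpace ℂ (Fin d)) ω M]
    (hM : IsTransversal d S M)
    (hbij : Function.Bijective (sliceMap hG hρ x S N)) {n : N}
    (hn : IsTransversalAt hG hρ x S N n)
    (hinv : (mfderiv (𝓘(ℂ, EuclideanSpace ℂ (Fin d)).prod 𝓘(ℂ, N)) 𝓘(ℂ, V)
      (mu ρ x M N) (⟨1, hM.one_mem⟩, n)).IsInvertible)
    {s r q : lieAlg G} (hs : s ∈ S) (hrx : dRep hG hρ r x = 0) (hrn : dRep hG hρ r (n : V) ∈ N)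
    (hqx : dRep hG hρ q x = 0) :
    dToMat d M ⟨1, hM.one_mem⟩ (pullbackAction
        (𝓘(ℂ, EuclideanSpace ℂ (Fin d)).prod 𝓘(ℂ, N)) (dRep hG hρ) (mu ρ x M N) (s + r + q)
          (⟨1, hM.one_mem⟩, n)).1 =
      ((s + (lamS hG hρ x S N (thetaInv hG hρ x S N n (dRep hG hρ q (n : V))) : lieAlg G) :
        lieAlg G) : Matrix (Fin m) (Fin m) ℂ) ∧
    (((pullbackAction (𝓘(ℂ, EuclideanSpace ℂ (Fin d)).prod 𝓘(ℂ, N)) (dRep hG hρ) (mu ρ x M N)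
        (s + r + q) (⟨1, hM.one_mem⟩, n)).2 : N) : V) =
      dRep hG hρ r (n : V) +
        (lamN hG hρ x S N (thetaInv hG hρ x S N n (dRep hG hρ q (n : V))) : V) := by
  have h1 := mfderiv_pullbackAction (dRep hG hρ) hinv (s + r + q)
  obtain ⟨w, u, hwu⟩ : ∃ (w : TangentSpace 𝓘(ℂ, EuclideanSpace ℂ (Fin d))
      (⟨1, hM.one_mem⟩ : M)) (u : N), pullbackAction
        (𝓘(ℂ, EuclideanSpace ℂ (Fin d)).prod 𝓘(ℂ, N)) (dRep hG hρ) (mu ρ x M N) (s + r + q)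
          (⟨1, hM.one_mem⟩, n) = (w, u) := ⟨_, _, rfl⟩
  rw [hwu] at h1 ⊢
  obtain ⟨t, ht, htw⟩ := hM.exists_dToMat_eq w
  have h2 := (hM.mfderiv_mu_one (hG := hG) (hρ := hρ) (x := x) n w u htw).symm.trans h1
  have h3 : mu ρ x M N (⟨1, hM.one_mem⟩, n) = x + (n : V) := by simp [mu]
  rw [h3] at h2
  -- Equivariance reads `t · (x + n) + u = (s + r + q) · (x + n)`, and `r` and `q` kill `x`. Moving
  -- `s · (x + n)` and `r · n` to the left leaves an equation of the form solved by `eq_of_add_eq`.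
  have h4 : dRep hG hρ (t - s) (x + (n : V)) + ((u : V) - dRep hG hρ r (n : V)) =
      dRep hG hρ q (n : V) := by
    have h5 : dRep hG hρ (s + r + q) (x + (n : V)) = dRep hG hρ s (x + (n : V)) +
        dRep hG hρ r (n : V) + dRep hG hρ q (n : V) := by
      rw [map_add (dRep hG hρ) (s + r) q, map_add (dRep hG hρ) s r, LinearMap.add_apply,
        LinearMap.add_apply, map_add (dRep hG hρ r),
        map_add (dRep hG hρ q), hrx, hqx, zero_add, zero_add]
    rw [h5] at h2
    rw [map_sub, LinearMap.sub_apply, sub_add_sub_comm, h2]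
    abel
  obtain ⟨h6, h7⟩ := hn.eq_of_add_eq hbij (S.sub_mem ht hs) (N.sub_mem u.2 hrn) h4
  constructor
  · rw [← h6, add_sub_cancel]
    exact htw.symm
  · rw [← h7, add_sub_cancel]

end Final

end LocalModel

/-! ### Assembly of the local model. -/

theorem mainTheorem1 {m : ℕ} (G : Subgroup (GL (Fin m) ℂ))
    (hG : LocalModel.IsZariskiClosed (G : Set (GL (Fin m) ℂ)))
    (hGconn : LocalModel.IsZariskiConnected (G : Set (GL (Fin m) ℂ)))
    (hGred : LocalModel.IsReductive G)
    {V : Type*} [NormedAddCommGroup V] [NormedSpace ℂ V] [FiniteDimensional ℂ V]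
    (ρ : Representation ℂ G V) (hρ : LocalModel.IsRational ρ) (x : V)
    (R Q : Subgroup (GL (Fin m) ℂ))
    (hLevi : LocalModel.IsLeviDecomposition (LocalModel.stabilizer ρ x) R Q)
    (S : Submodule ℂ (LocalModel.lieAlg G))
    (hS : IsCompl S (LocalModel.lieIn G (LocalModel.stabilizer ρ x)))
    (hSR : ∀ r ∈ R, ∀ s ∈ S, ∃ s' ∈ S, (s' : Matrix (Fin m) (Fin m) ℂ) =
      (r : Matrix (Fin m) (Fin m) ℂ) * (s : Matrix (Fin m) (Fin m) ℂ) *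
        ((r⁻¹ : GL (Fin m) ℂ) : Matrix (Fin m) (Fin m) ℂ))
    (N : Submodule ℂ V)
    (hN : IsCompl (LocalModel.orbitTangent hG hρ x) N)
    (hNR : ∀ r : G, (r : GL (Fin m) ℂ) ∈ R → ∀ n ∈ N, ρ r n ∈ N) :
    -- the decompositions `V = S · x ⊕ N` and `𝓖 = S ⊕ 𝓡 ⊕ 𝓠`
    Function.Bijective (LocalModel.sliceMap hG hρ x S N) ∧
    (∀ g : LocalModel.lieAlg G, ∃! t : S × LocalModel.lieIn G R × LocalModel.lieIn G Q,
      g = (t.1 : LocalModel.lieAlg G) + (t.2.1 : LocalModel.lieAlg G)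
        + (t.2.2 : LocalModel.lieAlg G)) ∧
    -- submanifolds of `G` through the identity with tangent space `S` exist
    (∃ (M : Set G) (_ : ChartedSpace (EuclideanSpace ℂ (Fin (Module.finrank ℂ S))) M)
      (_ : IsManifold 𝓘(ℂ, EuclideanSpace ℂ (Fin (Module.finrank ℂ S))) ω M),
      LocalModel.IsTransversal (Module.finrank ℂ S) S M) ∧
    -- each of them gives a local model
    ∀ (d : ℕ) (M : Set G) [ChartedSpace (EuclideanSpace ℂ (Fin d)) M]
      [IsManifold 𝓘(ℂ, EuclideanSpace ℂ (Fin d)) ω M] (hM : LocalModel.IsTransversal d S M),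
      ∃ (M' : Set M) (N' : Set N), IsOpen M' ∧ (⟨1, hM.one_mem⟩ : M) ∈ M' ∧
        IsOpen N' ∧ (0 : N) ∈ N' ∧
        -- `M' × N'` is a submanifold of `G ×_H V`
        Topology.IsEmbedding (fun p : (M' ×ˢ N' : Set (M × N)) =>
          (Quotient.mk (LocalModel.assocSetoid ρ x) ((p.1.1 : G), (p.1.2 : V)) :
            LocalModel.AssocBundle ρ x)) ∧
        (∀ p ∈ M', ∀ n ∈ N', ∀ (w : TangentSpace 𝓘(ℂ, EuclideanSpace ℂ (Fin d)) p) (u : N),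
          ∀ h ∈ LocalModel.lieIn G (LocalModel.stabilizer ρ x),
            LocalModel.dToMat d M p w = -(Matrix.of (LocalModel.toMat M p) * h) →
            (u : V) = LocalModel.dRep hG hρ h (n : V) → w = 0 ∧ u = 0) ∧
        -- `μ` is biholomorphic from `M' × N'` onto an open neighbourhood of `x`
        (∃ Φ : OpenPartialHomeomorph (M × N) V, Φ.source = M' ×ˢ N' ∧ x ∈ Φ.target ∧
          (∀ p ∈ M' ×ˢ N', Φ p = LocalModel.mu ρ x M N p) ∧
          ContMDiffOn (𝓘(ℂ, EuclideanSpace ℂ (Fin d)).prod 𝓘(ℂ, N)) 𝓘(ℂ, V) ω Φ Φ.source ∧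
          ContMDiffOn 𝓘(ℂ, V) (𝓘(ℂ, EuclideanSpace ℂ (Fin d)).prod 𝓘(ℂ, N)) ω
            Φ.symm Φ.target) ∧
        -- the action of `𝓖` on `M' × N'`, for which `μ` is equivariant
        (∃ γ : LocalModel.lieAlg G →ₗ[ℂ] ((p : M × N) →
            TangentSpace (𝓘(ℂ, EuclideanSpace ℂ (Fin d)).prod 𝓘(ℂ, N)) p),
          LocalModel.IsInfinitesimalAction
            (𝓘(ℂ, EuclideanSpace ℂ (Fin d)).prod 𝓘(ℂ, N)) γ (M' ×ˢ N') ∧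
          (∀ g : LocalModel.lieAlg G, ∀ p ∈ M' ×ˢ N',
            mfderiv (𝓘(ℂ, EuclideanSpace ℂ (Fin d)).prod 𝓘(ℂ, N)) 𝓘(ℂ, V)
              (LocalModel.mu ρ x M N) p (γ g p) =
                LocalModel.dRep hG hρ g (LocalModel.mu ρ x M N p)) ∧
          -- the explicit formula for the action at `(e, n)`
          ∀ n ∈ N', ∀ s ∈ S, ∀ r ∈ LocalModel.lieIn G R, ∀ q ∈ LocalModel.lieIn G Q,
            LocalModel.dToMat d M ⟨1, hM.one_mem⟩ (γ (s + r + q) (⟨1, hM.one_mem⟩, n)).1 =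
              ((s + (LocalModel.lamS hG hρ x S N (LocalModel.thetaInv hG hρ x S N n
                (LocalModel.dRep hG hρ q (n : V))) : LocalModel.lieAlg G) :
                  LocalModel.lieAlg G) : Matrix (Fin m) (Fin m) ℂ) ∧
            (((γ (s + r + q) (⟨1, hM.one_mem⟩, n)).2 : N) : V) =
              LocalModel.dRep hG hρ r (n : V) +
                (LocalModel.lamN hG hρ x S N (LocalModel.thetaInv hG hρ x S N n
                  (LocalModel.dRep hG hρ q (n : V))) : V)) ∧
        -- the stabilizers of the points `x + n`
        ∀ n ∈ N', IsUnit (1 + LocalModel.theta hG hρ x S N n) ∧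
          ∃ Hn : Submodule ℂ (LocalModel.lieAlg G),
            Hn ≤ LocalModel.lieIn G (LocalModel.stabilizer ρ x) ∧
            Module.finrank ℂ Hn = Module.finrank ℂ
              (LocalModel.lieIn G (LocalModel.stabilizer ρ (x + (n : V)))) ∧
            (∀ r ∈ LocalModel.lieIn G R, ∀ q ∈ LocalModel.lieIn G Q, q + r ∈ Hn ↔
              LocalModel.dRep hG hρ r (n : V) +
                (LocalModel.lamN hG hρ x S N (LocalModel.thetaInv hG hρ x S N n
                  (LocalModel.dRep hG hρ q (n : V))) : V) = 0) ∧
            (∀ g ∈ LocalModel.lieIn G (LocalModel.stabilizer ρ (x + (n : V))),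
              ∃! h : LocalModel.lieAlg G, h ∈ Hn ∧
                ∃ r ∈ LocalModel.lieIn G R, ∃ q ∈ LocalModel.lieIn G Q, h = q + r ∧
                  LocalModel.dRep hG hρ r (n : V) +
                    (LocalModel.lamN hG hρ x S N (LocalModel.thetaInv hG hρ x S N n
                      (LocalModel.dRep hG hρ q (n : V))) : V) = 0 ∧
                  g = h + -(LocalModel.lamS hG hρ x S N (LocalModel.thetaInv hG hρ x S N n
                    (LocalModel.dRep hG hρ q (n : V))) : LocalModel.lieAlg G)) ∧
            (∀ h ∈ Hn, ∃! s : LocalModel.lieAlg G, s ∈ S ∧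
              h + s ∈ LocalModel.lieIn G (LocalModel.stabilizer ρ (x + (n : V)))) := by
  have hH : ∀ X, X ∈ LocalModel.lieIn G (LocalModel.stabilizer ρ x) ↔
    LocalModel.dRep hG hρ X x = 0 := fun X => LocalModel.mem_lieIn_stabilizer hG hρ
  have hbij := LocalModel.sliceMap_bijective hG hρ hS hN
  have hR : LocalModel.lieIn G R ≤ LocalModel.lieIn G (LocalModel.stabilizer ρ x) :=
    LocalModel.lieIn_mono G hLevi.le
  have hQ : LocalModel.lieIn G Q ≤ LocalModel.lieIn G (LocalModel.stabilizer ρ x) :=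
    LocalModel.lieIn_mono G hLevi.radical.le
  have hRN : ∀ r ∈ LocalModel.lieIn G R, ∀ n : N, LocalModel.dRep hG hρ r (n : V) ∈ N :=
    fun r hr n => LocalModel.dRep_mem_of_invariant hG hρ hLevi.reductive.closed hNR hr n.2
  refine ⟨hbij, LocalModel.existsUnique_decomposition hG hρ hLevi hS,
    LocalModel.exists_isTransversal hG S, ?_⟩
  intro d M _ _ hM
  have hmu := LocalModel.contMDiff_mu (x := x) (N := N) hρ hG hM.holomorphic
  obtain ⟨A, hA⟩ := hM.exists_hasMFDerivAt_mu hbij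
  obtain ⟨Φ₀, hp₀, hΦ₀, hΦ₀s⟩ := LocalModel.exists_openPartialHomeomorph_of_mfderiv hmu hA
  -- The inverse function theorem gives some open neighbourhood of `(e, 0)`; it is shrunk to a
  -- product box.
  obtain ⟨M', N', hM', hN', hone, hzero, hsub⟩ := isOpen_prod_iff.1 Φ₀.open_source _ _ hp₀
  let Φ := Φ₀.restrOpen (M' ×ˢ N') (hM'.prod hN')
  have hsource : Φ.source = M' ×ˢ N' := Set.inter_eq_right.2 hsub
  have hΦ : ∀ p ∈ Φ.source, Φ p = LocalModel.mu ρ x M N p := fun p hp => hΦ₀ p hp.1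
  have hΦs : ContMDiffOn 𝓘(ℂ, V) (𝓘(ℂ, EuclideanSpace ℂ (Fin d)).prod 𝓘(ℂ, N)) ω
      Φ.symm Φ.target := hΦ₀s.mono fun y hy => hy.1
  have hinv : ∀ p ∈ M' ×ˢ N', (mfderiv (𝓘(ℂ, EuclideanSpace ℂ (Fin d)).prod 𝓘(ℂ, N)) 𝓘(ℂ, V)
      (LocalModel.mu ρ x M N) p).IsInvertible := fun p hp =>
    LocalModel.isInvertible_mfderiv_of_openPartialHomeomorph hmu hΦ hΦs (hsource ▸ hp)
  -- Since `e ∈ M'`, the derivative of `mu` is invertible at `(e, n)` for every `n ∈ N'`.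
  -- Invertibility of `1 + θ(n)` thus needs no further shrinking of `N'`.
  have htrans : ∀ n ∈ N', LocalModel.IsTransversalAt hG hρ x S N n := fun n hn =>
    hM.isTransversalAt (hinv (_, n) ⟨hone, hn⟩).injective
  refine ⟨M', N', hM', hone, hN', hzero, ?_, ?_, ?_, ?_, ?_⟩
  · rw [← hsource]
    exact LocalModel.isEmbedding_mk hG hρ hΦ
  · intro p hp n hn w u h hh hw hu
    exact hM.eq_zero_of_orbit (hinv (p, n) ⟨hp, hn⟩).injective hh hw hu
  · refine ⟨Φ, hsource, ?_, fun p hp => hΦ p (hsource ▸ hp), ?_, hΦs⟩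
    · have h1 : Φ (⟨1, hM.one_mem⟩, 0) = x := by
        rw [hΦ _ (hsource ▸ ⟨hone, hzero⟩)]
        simp [LocalModel.mu]
      rw [← h1]
      exact Φ.map_source (hsource ▸ ⟨hone, hzero⟩)
    · exact hmu.contMDiffOn.congr hΦ
  · refine ⟨LocalModel.pullbackAction _ (LocalModel.dRep hG hρ) (LocalModel.mu ρ x M N),
      LocalModel.isInfinitesimalAction_pullbackAction _ (LocalModel.dRep_lie hG hρ) hmu hinv,
      fun g p hp => LocalModel.mfderiv_pullbackAction _ (hinv p hp) g, ?_⟩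
    intro n hn s hs r hr q hq
    exact hM.pullbackAction_one hbij (htrans n hn) (hinv (_, n) ⟨hone, hn⟩) hs (hH r |>.1 (hR hr))
      (hRN r hr n) (hH q |>.1 (hQ hq))
  · intro n hn
    exact ⟨(htrans n hn).isUnit hbij, (htrans n hn).exists_submodule hbij hS hR hQ
      (fun X hX => hLevi.exists_add hG hρ hX) (fun r hr => hRN r hr n)⟩
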